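/- Order $\{0,1,2\}^n$ coordinatewise, let the rank of a vector be the sum of its coordinates, let $L_i$ ($0\le i\le 2n$) be the set of vectors of rank $i$ and $\ell_i(n)=|L_i|$. Let $L_i^s$, $L_i^{\ge s}$, $L_i^{\le s}$ be the sets of those $x\in L_i$ with exactly, at least, at most $s$ coordinates equal to $2$. For $0\le i\le 2n-1$ and $\max\{0,i-n\}\le s\le\lfloor i/2\rfloor$ put \[w_{i,s}=\frac{|L_i||L_{i+1}^{\ge s+1}|-|L_{i+1}||L_i^{\ge s+1}|}{|L_i^s||L_i||L_{i+1}|(i-2s)}\ \text{ if } i\ne 2s,\qquad w_{i,s}=0 \text{ if } i=2s,\] \[w'_{i,s}=\frac{|L_i||L_{i+1}^{\le s}|-|L_{i+1}||L_i^{\le s-1}|}{|L_i^s||L_i||L_{i+1}|(n-i+s)}\ \text{ if } i\ne n+s,\qquad w'_{i,s}=0 \text{ if } i=n+s.\] These numbers are non-negative and $(i-2s)w_{i,s}+(n-i+s)w'_{i,s}=1/|L_i|$. Let $\mu$ be the distribution of the random maximal chain $\mathcal C_\mu$ of $\{0,1,2\}^n$ built level by level as follows: it starts at $(0,\dots,0)$;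 if the last element chosen so far is $x\in L_i^s$ with $i<2n$, then, independently of the earlier elements, the next element is $y$ with probability $|L_i|w_{i,s}$ for each $y\in L_{i+1}^{s+1}$ with $x<y$, and with probability $|L_i|w'_{i,s}$ for each $y\in L_{i+1}^{s}$ with $x<y$. Lemma. For every integer $k\ge 1$ there is $n_0(k)$ such that the following holds for all $n\ge n_0(k)$. Let $0\le i,j\le 2n$ be integers such that - $|i-j|\ge k$, - either $\min\{i,j\}\ge 2k$ or $\max\{i,j\}\le 2n-2k$, and - $|j-n|\le|i-n|$. If $x\in L_i$ and $y\in L_j$ are comparable (that is, $x\le y$ or $y\le x$), then \[\mathbb P\left(y\in\mathcal C_\mu\mid x\in\mathcal C_\mu\right)\le\left(\frac{\ell_{3k-1}(n)}{\ell_{2k-1}(n)}-1\right)^{-1}.\] -/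

import Mathlib

open Finset

/-- The poset `{0,1,2}^n`, ordered coordinatewise. -/
abbrev Vec (n : ℕ) : Type := Fin n → Fin 3

namespace Vec

/-- The rank of a vector: the sum of its coordinates. -/
def rank {n : ℕ} (x : Vec n) : ℕ := ∑ a, (x a : ℕ)

/-- The number of coordinates equal to `2`. -/
def twos {n : ℕ} (x : Vec n) : ℕ := #{a | x a = 2}

/-- The level `L_i`. -/
def level (n i : ℕ) : Finset (Vec n) := {x | rank x = i}

/-- `ℓ_i(n)`, the size of the level `L_i`. -/
def ell (n i : ℕ) : ℕ := #(level n i)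

/-- `L_i^s`: the vectors of rank `i` with exactly `s` coordinates equal to `2`. -/
def levelEq (n i s : ℕ) : Finset (Vec n) := {x | rank x = i ∧ twos x = s}

/-- `L_i^{≥ s}`: the vectors of rank `i` with at least `s` coordinates equal to `2`. -/
def levelGE (n i s : ℕ) : Finset (Vec n) := {x | rank x = i ∧ s ≤ twos x}

/-- `L_i^{≤ s - 1}`: the vectors of rank `i` with fewer than `s` coordinates equal to `2`
(so that `L_i^{≤ s}` is `levelLT n i (s + 1)`). -/
def levelLT (n i s : ℕ) : Finset (Vec n) := {x | rank x = i ∧ twos x < s}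

/-- The weight `w_{i,s}` which a vector of `L_i^s` sends to each vector of `L_{i+1}^{s+1}`
above it. -/
noncomputable def w (n i s : ℕ) : ℝ :=
  if i = 2 * s then 0 else
    ((#(level n i) : ℝ) * #(levelGE n (i + 1) (s + 1))
        - #(level n (i + 1)) * #(levelGE n i (s + 1))) /
      (#(levelEq n i s) * #(level n i) * #(level n (i + 1)) * ((i : ℝ) - 2 * s))

/-- The weight `w'_{i,s}` which a vector of `L_i^s` sends to each vector of `L_{i+1}^s`
above it. -/
noncomputable def w' (n i s : ℕ) : ℝ :=
  if i = n + s then 0 else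
    ((#(level n i) : ℝ) * #(levelLT n (i + 1) (s + 1))
        - #(level n (i + 1)) * #(levelLT n i s)) /
      (#(levelEq n i s) * #(level n i) * #(level n (i + 1)) * ((n : ℝ) - i + s))

open Classical in
/-- The probability with which a chain that has been built up to `x` is continued by `y`. For
`x ∈ L_i^s` it is `|L_i| w_{i,s}` if `y` is a vector of `L_{i+1}^{s+1}` above `x`, it is
`|L_i| w'_{i,s}` if `y` is a vector of `L_{i+1}^s` above `x`, and it is `0` otherwise. (For `x = 0`
this is the uniform distribution on `L_1`; for `x` of rank `2 n - 1` it is concentrated at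
`(2, …, 2)`.) -/
noncomputable def stepProb {n : ℕ} (x y : Vec n) : ℝ :=
  if x < y ∧ rank y = rank x + 1 then
    if twos y = twos x + 1 then #(level n (rank x)) * w n (rank x) (twos x)
    else #(level n (rank x)) * w' n (rank x) (twos x)
  else 0

/-! The facts below show that `stepProb x` is a probability distribution. -/

lemma fin3_cases (v : Fin 3) : v = 0 ∨ v = 1 ∨ v = 2 := by
  fin_cases v <;> simp

/-- Raise the coordinate `a` by one. -/
def raise {n : ℕ} (x : Vec n) (a : Fin n) : Vec n := Function.update x a (x a + 1)

lemma rank_update {n : ℕ} (x : Vec n) (a : Fin n) (v : Fin 3) :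
    rank (Function.update x a v) + (x a : ℕ) = rank x + (v : ℕ) := by
  unfold rank
  rw [← Finset.add_sum_erase _ _ (mem_univ a),
    ← Finset.add_sum_erase _ (fun b => (x b : ℕ)) (mem_univ a)]
  have : ∑ b ∈ univ.erase a, ((Function.update x a v b : Fin 3) : ℕ)
      = ∑ b ∈ univ.erase a, (x b : ℕ) := by
    refine Finset.sum_congr rfl fun b hb => ?_
    rw [Function.update_of_ne (Finset.ne_of_mem_erase hb)]
  simp only [this, Function.update_self]
  omega

lemma twos_eq_sum {n : ℕ} (x : Vec n) : twos x = ∑ a, if x a = 2 then 1 else 0 := by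
  unfold twos; rw [Finset.card_filter]

lemma twos_update {n : ℕ} (x : Vec n) (a : Fin n) (v : Fin 3) :
    twos (Function.update x a v) + (if x a = 2 then 1 else 0)
      = twos x + (if v = 2 then 1 else 0) := by
  rw [twos_eq_sum, twos_eq_sum, ← Finset.add_sum_erase _ _ (mem_univ a),
    ← Finset.add_sum_erase _ (fun b => if x b = 2 then 1 else 0) (mem_univ a)]
  have : ∑ b ∈ univ.erase a, (if Function.update x a v b = 2 then 1 else 0)
      = ∑ b ∈ univ.erase a, if x b = 2 then 1 else 0 := by
    refine Finset.sum_congr rfl fun b hb => ?_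
    rw [Function.update_of_ne (Finset.ne_of_mem_erase hb)]
  simp only [this, Function.update_self]
  omega

lemma rank_eq {n : ℕ} (x : Vec n) : rank x = #{a | x a = 1} + 2 * twos x := by
  rw [twos_eq_sum, Finset.card_filter, Finset.mul_sum, ← Finset.sum_add_distrib, rank]
  refine Finset.sum_congr rfl fun a _ => ?_
  rcases fin3_cases (x a) with h | h | h <;> simp [h]

lemma card_eq {n : ℕ} (x : Vec n) : n = #{a | x a = 0} + #{a | x a = 1} + twos x := by
  rw [twos_eq_sum, Finset.card_filter, Finset.card_filter, ← Finset.sum_add_distrib,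
    ← Finset.sum_add_distrib]
  conv_lhs => rw [← Fintype.card_fin n, Fintype.card_eq_sum_ones]
  refine Finset.sum_congr rfl fun a _ => ?_
  rcases fin3_cases (x a) with h | h | h <;> simp [h]

lemma ones_real {n i s : ℕ} {x : Vec n} (hx : x ∈ levelEq n i s) :
    (#{a | x a = 1} : ℝ) = i - 2 * s := by
  obtain ⟨rfl, rfl⟩ : rank x = i ∧ twos x = s := by simpa [levelEq] using hx
  rw [rank_eq]; push_cast; ring

lemma zeros_real {n i s : ℕ} {x : Vec n} (hx : x ∈ levelEq n i s) :
    (#{a | x a = 0} : ℝ) = n - i + s := by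
  have h1 := ones_real hx
  obtain ⟨rfl, rfl⟩ : rank x = i ∧ twos x = s := by simpa [levelEq] using hx
  have h2 : (n : ℝ) = #{a | x a = 0} + #{a | x a = 1} + twos x := by exact_mod_cast card_eq x
  linarith

/-- Count the pairs consisting of a vector of one class and a coordinate with value `u`, by
changing that coordinate to `v`. -/
lemma sum_switch {n i s j t : ℕ} (u v : Fin 3)
    (hij : i + (v : ℕ) = j + (u : ℕ))
    (hst : s + (if v = 2 then 1 else 0) = t + (if u = 2 then 1 else 0)) :
    ∑ x ∈ levelEq n i s, #{a | x a = u} = ∑ y ∈ levelEq n j t, #{a | y a = v} := by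
  rw [← Finset.card_sigma, ← Finset.card_sigma]
  refine Finset.card_nbij' (fun p => ⟨Function.update p.1 p.2 v, p.2⟩)
    (fun p => ⟨Function.update p.1 p.2 u, p.2⟩) ?_ ?_ ?_ ?_
  · rintro ⟨x, a⟩ h
    simp only [levelEq, coe_sigma, Set.mem_sigma_iff, coe_filter, mem_univ, true_and,
      Set.mem_ofPred_eq] at h ⊢
    obtain ⟨⟨h1, h2⟩, h3⟩ := h
    have e1 := rank_update x a v
    have e2 := twos_update x a v
    rw [h3] at e1 e2
    refine ⟨⟨by omega, by omega⟩, by simp⟩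
  · rintro ⟨x, a⟩ h
    simp only [levelEq, coe_sigma, Set.mem_sigma_iff, coe_filter, mem_univ, true_and,
      Set.mem_ofPred_eq] at h ⊢
    obtain ⟨⟨h1, h2⟩, h3⟩ := h
    have e1 := rank_update x a u
    have e2 := twos_update x a u
    rw [h3] at e1 e2
    refine ⟨⟨by omega, by omega⟩, by simp⟩
  · rintro ⟨x, a⟩ h
    simp only [coe_sigma, Set.mem_sigma_iff, coe_filter, mem_univ, true_and,
      Set.mem_ofPred_eq] at h
    simp [← h.2]
  · rintro ⟨x, a⟩ h
    simp only [coe_sigma, Set.mem_sigma_iff, coe_filter, mem_univ, true_and,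
      Set.mem_ofPred_eq] at h
    simp [← h.2]

lemma card_mul_same (n i s : ℕ) :
    (#(levelEq n (i + 1) s) : ℝ) * (i + 1 - 2 * s) = #(levelEq n i s) * (n - i + s) := by
  have h : (∑ x ∈ levelEq n i s, (#{a | x a = 0} : ℝ))
      = ∑ y ∈ levelEq n (i + 1) s, (#{a | y a = 1} : ℝ) := by
    exact_mod_cast sum_switch (n := n) (i := i) (s := s) (j := i + 1) (t := s) 0 1
      (by simp) (by simp)
  rw [Finset.sum_congr rfl fun x hx => zeros_real hx,
    Finset.sum_congr rfl fun x hx => ones_real hx] at h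
  simp only [sum_const, nsmul_eq_mul] at h
  push_cast at h
  linarith

lemma card_mul_succ (n i s : ℕ) :
    (#(levelEq n (i + 1) (s + 1)) : ℝ) * (s + 1) = #(levelEq n i s) * (i - 2 * s) := by
  have h : (∑ x ∈ levelEq n i s, (#{a | x a = 1} : ℝ))
      = ∑ y ∈ levelEq n (i + 1) (s + 1), (#{a | y a = 2} : ℝ) := by
    exact_mod_cast sum_switch (n := n) (i := i) (s := s) (j := i + 1) (t := s + 1) 1 2
      (by simp) (by simp)
  rw [Finset.sum_congr rfl fun x hx => ones_real hx] at h
  have h2 : ∀ y ∈ levelEq n (i + 1) (s + 1), (#{a | y a = 2} : ℝ) = s + 1 := by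
    intro y hy
    have : twos y = s + 1 := by simp [levelEq] at hy; exact hy.2
    exact_mod_cast this
  rw [Finset.sum_congr rfl h2] at h
  simp only [sum_const, nsmul_eq_mul] at h
  linarith

lemma levelEq_bounds {n i s : ℕ} (h : 0 < (#(levelEq n i s) : ℝ)) :
    0 ≤ (i : ℝ) - 2 * s ∧ 0 ≤ (n : ℝ) - i + s := by
  obtain ⟨x, hx⟩ := Finset.card_pos.1 (by exact_mod_cast h : 0 < #(levelEq n i s))
  rw [← ones_real hx, ← zeros_real hx]
  exact ⟨by positivity, by positivity⟩

lemma cross_same {n i q r : ℕ} (hqr : q < r) :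
    (#(levelEq n (i + 1) q) : ℝ) * #(levelEq n i r)
      ≤ #(levelEq n i q) * #(levelEq n (i + 1) r) := by
  rcases (Nat.cast_nonneg (α := ℝ) #(levelEq n i r)).eq_or_lt with h | hr
  · rw [← h, mul_zero]; positivity
  rcases (Nat.cast_nonneg (α := ℝ) #(levelEq n (i + 1) q)).eq_or_lt with h | hq
  · rw [← h, zero_mul]; positivity
  have b1 := levelEq_bounds hr
  have b2 := levelEq_bounds hq
  push_cast at b2
  have hqr' : (q : ℝ) + 1 ≤ r := by exact_mod_cast hqr
  have e1 := card_mul_same n i q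
  have e2 := card_mul_same n i r
  have p1 : 0 < (i : ℝ) + 1 - 2 * q := by linarith
  have p2 : 0 < (n : ℝ) - i + r := by linarith
  refine le_of_mul_le_mul_right ?_ (mul_pos p1 p2)
  have key : ((n : ℝ) - i + q) * (i + 1 - 2 * r) ≤ (i + 1 - 2 * q) * (n - i + r) := by
    apply (mul_comm _ _).le.trans
    exact mul_le_mul (by linarith) (by linarith) (by linarith) p1.le
  calc _ = (#(levelEq n (i + 1) q) * ((i : ℝ) + 1 - 2 * q)) * (#(levelEq n i r) * (n - i + r)) := by
        ring
    _ = #(levelEq n i q) * #(levelEq n (i + 1) r) * (((n : ℝ) - i + q) * (i + 1 - 2 * r)) := by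
        rw [e1, ← e2]; ring
    _ ≤ _ := by gcongr

lemma cross_succ {n i q r : ℕ} (hqr : q < r) :
    (#(levelEq n (i + 1) (r + 1)) : ℝ) * #(levelEq n i q)
      ≤ #(levelEq n i r) * #(levelEq n (i + 1) (q + 1)) := by
  rcases (Nat.cast_nonneg (α := ℝ) #(levelEq n i q)).eq_or_lt with h | hq
  · rw [← h, mul_zero]; positivity
  have b1 := levelEq_bounds hq
  have hqr' : (q : ℝ) + 1 ≤ r := by exact_mod_cast hqr
  have e1 := card_mul_succ n i q
  have e2 := card_mul_succ n i r
  have p1 : 0 < ((r : ℝ) + 1) * (q + 1) := by positivity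
  refine le_of_mul_le_mul_right ?_ p1
  have key : ((i : ℝ) - 2 * r) * (q + 1) ≤ (i - 2 * q) * (r + 1) :=
    mul_le_mul (by linarith) (by linarith) (by positivity) b1.1
  calc _ = (#(levelEq n (i + 1) (r + 1)) * ((r : ℝ) + 1)) * #(levelEq n i q) * (q + 1) := by ring
    _ = #(levelEq n i r) * #(levelEq n i q) * (((i : ℝ) - 2 * r) * (q + 1)) := by
        rw [e2]; ring
    _ ≤ #(levelEq n i r) * #(levelEq n i q) * (((i : ℝ) - 2 * q) * (r + 1)) := by gcongr
    _ = #(levelEq n i r) * (#(levelEq n i q) * ((i : ℝ) - 2 * q)) * (r + 1) := by ring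
    _ = _ := by rw [← e1]; ring

lemma twos_le {n : ℕ} (x : Vec n) : twos x ≤ n := by
  have := card_eq x; omega

lemma card_levelLT (n i s : ℕ) : #(levelLT n i s) = ∑ q ∈ range s, #(levelEq n i q) := by
  rw [Finset.card_eq_sum_card_fiberwise (f := twos) (t := range s)]
  · refine Finset.sum_congr rfl fun q hq => ?_
    congr 1
    ext x
    simp only [levelLT, levelEq, mem_filter, mem_univ, true_and, mem_range] at hq ⊢
    constructor
    · rintro ⟨⟨h1, -⟩, h3⟩; exact ⟨h1, h3⟩
    · rintro ⟨h1, h2⟩; exact ⟨⟨h1, by omega⟩, h2⟩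
  · intro x hx
    simp only [levelLT, coe_filter, mem_univ, true_and, Set.mem_ofPred_eq] at hx
    simpa using hx.2

lemma card_levelGE (n i s : ℕ) :
    #(levelGE n i s) = ∑ q ∈ Ico s (n + 2), #(levelEq n i q) := by
  rw [Finset.card_eq_sum_card_fiberwise (f := twos) (t := Ico s (n + 2))]
  · refine Finset.sum_congr rfl fun q hq => ?_
    congr 1
    ext x
    simp only [levelGE, levelEq, mem_filter, mem_univ, true_and, mem_Ico] at hq ⊢
    constructor
    · rintro ⟨⟨h1, -⟩, h3⟩; exact ⟨h1, h3⟩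
    · rintro ⟨h1, h2⟩; exact ⟨⟨h1, by omega⟩, h2⟩
  · intro x hx
    simp only [levelGE, coe_filter, mem_univ, true_and, Set.mem_ofPred_eq] at hx
    have := twos_le x
    simp only [coe_Ico, Set.mem_Ico]
    omega

lemma card_level (n i s : ℕ) : #(level n i) = #(levelLT n i s) + #(levelGE n i s) := by
  rw [← Finset.card_filter_add_card_filter_not (s := level n i) (fun x => twos x < s)]
  congr 2 <;> ext x <;> simp [level, levelLT, levelGE]

lemma w_num_nonneg (n i s : ℕ) :
    0 ≤ (#(level n i) : ℝ) * #(levelGE n (i + 1) (s + 1))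
        - #(level n (i + 1)) * #(levelGE n i (s + 1)) := by
  rw [card_level n i (s + 1), card_level n (i + 1) (s + 1)]
  have : (#(levelLT n (i + 1) (s + 1)) : ℝ) * #(levelGE n i (s + 1))
      ≤ #(levelLT n i (s + 1)) * #(levelGE n (i + 1) (s + 1)) := by
    simp only [card_levelLT, card_levelGE, Nat.cast_sum, Finset.sum_mul_sum]
    refine Finset.sum_le_sum fun q hq => Finset.sum_le_sum fun r hr => cross_same ?_
    rw [mem_range] at hq; rw [mem_Ico] at hr; omega
  push_cast
  linarith

lemma w'_num_nonneg (n i s : ℕ) :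
    0 ≤ (#(level n i) : ℝ) * #(levelLT n (i + 1) (s + 1))
        - #(level n (i + 1)) * #(levelLT n i s) := by
  rw [card_level n i s, card_level n (i + 1) (s + 1)]
  have h1 : #(levelLT n (i + 1) (s + 1))
      = #(levelEq n (i + 1) 0) + ∑ q ∈ range s, #(levelEq n (i + 1) (q + 1)) := by
    rw [card_levelLT, Finset.sum_range_succ', add_comm]
  have h2 : #(levelGE n (i + 1) (s + 1)) ≤ ∑ r ∈ Ico s (n + 2), #(levelEq n (i + 1) (r + 1)) := by
    rw [card_levelGE, Finset.sum_Ico_add' (fun r => #(levelEq n (i + 1) r))]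
    exact Finset.sum_le_sum_of_subset (Finset.Ico_subset_Ico_right (by omega))
  have h2' : (#(levelGE n (i + 1) (s + 1)) : ℝ)
      ≤ ∑ r ∈ Ico s (n + 2), (#(levelEq n (i + 1) (r + 1)) : ℝ) := by exact_mod_cast h2
  have : (#(levelGE n (i + 1) (s + 1)) : ℝ) * #(levelLT n i s)
      ≤ #(levelGE n i s) * #(levelLT n (i + 1) (s + 1)) := by
    calc _ ≤ (∑ r ∈ Ico s (n + 2), (#(levelEq n (i + 1) (r + 1)) : ℝ)) * #(levelLT n i s) := by
          gcongr
      _ ≤ #(levelGE n i s) * ∑ q ∈ range s, (#(levelEq n (i + 1) (q + 1)) : ℝ) := by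
          simp only [card_levelLT, card_levelGE, Nat.cast_sum, Finset.sum_mul_sum]
          refine Finset.sum_le_sum fun r hr => Finset.sum_le_sum fun q hq => ?_
          rw [mem_range] at hq; rw [mem_Ico] at hr
          rcases (show q ≤ r by omega).eq_or_lt with h | h
          · rw [h, mul_comm]
          · exact cross_succ h
      _ ≤ _ := by
          rw [h1]; push_cast
          gcongr
          linarith [Nat.cast_nonneg (α := ℝ) #(levelEq n (i + 1) 0)]
  push_cast
  linarith

lemma mem_levelEq_self {n : ℕ} (x : Vec n) : x ∈ levelEq n (rank x) (twos x) := by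
  simp [levelEq]

lemma w_nonneg {n : ℕ} (x : Vec n) : 0 ≤ w n (rank x) (twos x) := by
  unfold w
  split_ifs
  · exact le_rfl
  · rw [← ones_real (mem_levelEq_self x)]
    exact div_nonneg (w_num_nonneg _ _ _) (by positivity)

lemma w'_nonneg {n : ℕ} (x : Vec n) : 0 ≤ w' n (rank x) (twos x) := by
  unfold w'
  split_ifs
  · exact le_rfl
  · rw [← zeros_real (mem_levelEq_self x)]
    exact div_nonneg (w'_num_nonneg _ _ _) (by positivity)

lemma stepProb_nonneg {n : ℕ} (x y : Vec n) : 0 ≤ stepProb x y := by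
  have := w_nonneg x
  have := w'_nonneg x
  unfold stepProb
  split_ifs <;> positivity

lemma rank_raise {n : ℕ} {x : Vec n} {a : Fin n} (ha : x a ≠ 2) :
    rank (raise x a) = rank x + 1 := by
  have := rank_update x a (x a + 1)
  unfold raise
  rcases fin3_cases (x a) with h | h | h
  · rw [h] at this ⊢; simpa using this
  · rw [h] at this ⊢; simp at this ⊢; omega
  · exact absurd h ha

lemma twos_raise {n : ℕ} {x : Vec n} {a : Fin n} (ha : x a ≠ 2) :
    twos (raise x a) = twos x + if x a = 1 then 1 else 0 := by
  have := twos_update x a (x a + 1)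
  unfold raise
  rcases fin3_cases (x a) with h | h | h
  · rw [h] at this ⊢; simpa using this
  · rw [h] at this ⊢; simpa using this
  · exact absurd h ha

lemma lt_raise {n : ℕ} {x : Vec n} {a : Fin n} (ha : x a ≠ 2) : x < raise x a := by
  refine lt_update_self_iff.2 ?_
  rcases fin3_cases (x a) with h | h | h
  · rw [h]; decide
  · rw [h]; decide
  · exact absurd h ha

lemma raise_injOn {n : ℕ} (x : Vec n) : Set.InjOn (raise x) {a | x a ≠ 2} := by
  intro a _ b _ hab
  by_contra hne
  have h := congrFun hab a
  simp only [raise, Function.update_self, Function.update_of_ne hne] at h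
  rcases fin3_cases (x a) with h' | h' | h' <;> rw [h'] at h <;> revert h <;> decide

open Classical in
lemma covers_eq {n : ℕ} (x : Vec n) :
    (univ.filter fun y : Vec n => x < y ∧ rank y = rank x + 1)
      = (univ.filter fun a => x a ≠ 2).image (raise x) := by
  ext y
  simp only [mem_filter, mem_univ, true_and, mem_image]
  constructor
  · rintro ⟨hlt, hr⟩
    obtain ⟨hle, a, ha⟩ := Pi.lt_def.1 hlt
    have ha2 : x a ≠ 2 := by
      intro h; rw [h] at ha
      exact absurd ha (not_lt.2 (Fin.le_last (y a)))
    have hle' : raise x a ≤ y := by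
      refine update_le_iff.2 ⟨?_, fun b _ => hle b⟩
      revert ha
      rcases fin3_cases (x a) with h | h | h
      · rw [h]; generalize y a = v; revert v; decide
      · rw [h]; generalize y a = v; revert v; decide
      · exact absurd h ha2
    refine ⟨a, ha2, ?_⟩
    have hs : ∑ b, ((raise x a b : Fin 3) : ℕ) = ∑ b, ((y b : Fin 3) : ℕ) := by
      have := rank_raise ha2
      unfold rank at this hr
      rw [this]; exact hr.symm
    have := (Finset.sum_eq_sum_iff_of_le (fun b _ => Fin.le_def.1 (hle' b))).1 hs
    funext b
    exact Fin.ext (this b (mem_univ b))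
  · rintro ⟨a, ha, rfl⟩
    exact ⟨lt_raise ha, rank_raise ha⟩

lemma exists_ne_two {n : ℕ} {x : Vec n} (hx : rank x < 2 * n) : ∃ a, x a ≠ 2 := by
  by_contra! h
  have : rank x = 2 * n := by simp [rank, h, mul_comm]
  omega

lemma weights_sum {n : ℕ} (x : Vec n) (hx : rank x < 2 * n) :
    (#{a | x a = 1} : ℝ) * (#(level n (rank x)) * w n (rank x) (twos x))
      + #{a | x a = 0} * (#(level n (rank x)) * w' n (rank x) (twos x)) = 1 := by
  have hxs := mem_levelEq_self x
  rw [ones_real hxs, zeros_real hxs]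
  have e1 := rank_eq x
  have e2 := card_eq x
  have pE : 0 < (#(levelEq n (rank x) (twos x)) : ℝ) := by
    exact_mod_cast Finset.card_pos.2 ⟨x, hxs⟩
  have pL : 0 < (#(level n (rank x)) : ℝ) := by
    exact_mod_cast Finset.card_pos.2 ⟨x, by simp [level]⟩
  have pL' : 0 < (#(level n (rank x + 1)) : ℝ) := by
    obtain ⟨a, ha⟩ := exists_ne_two hx
    exact_mod_cast Finset.card_pos.2 ⟨raise x a, by simp [level, rank_raise ha]⟩
  generalize hi : rank x = i at *
  generalize hs : twos x = s at *
  have c1 : (#(level n i) : ℝ) = #(levelLT n i s) + #(levelGE n i s) := by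
    exact_mod_cast card_level n i s
  have c1' : (#(level n i) : ℝ) = #(levelLT n i (s + 1)) + #(levelGE n i (s + 1)) := by
    exact_mod_cast card_level n i (s + 1)
  have c2 : (#(level n (i + 1)) : ℝ)
      = #(levelLT n (i + 1) (s + 1)) + #(levelGE n (i + 1) (s + 1)) := by
    exact_mod_cast card_level n (i + 1) (s + 1)
  have c3 : (#(levelLT n i (s + 1)) : ℝ) = #(levelLT n i s) + #(levelEq n i s) := by
    rw [card_levelLT, card_levelLT, Finset.sum_range_succ]; push_cast; ring
  -- the two extreme cases
  have g1 : i = 2 * s → (#(levelGE n (i + 1) (s + 1)) : ℝ) = 0 ∧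
      (#(levelGE n i (s + 1)) : ℝ) = 0 := by
    intro h
    constructor <;>
    · rw [Nat.cast_eq_zero, Finset.card_eq_zero, Finset.eq_empty_iff_forall_notMem]
      intro y hy
      simp only [levelGE, mem_filter, mem_univ, true_and] at hy
      have := rank_eq y
      omega
  have g2 : i = n + s → (#(levelLT n (i + 1) (s + 1)) : ℝ) = 0 ∧
      (#(levelLT n i s) : ℝ) = 0 := by
    intro h
    constructor <;>
    · rw [Nat.cast_eq_zero, Finset.card_eq_zero, Finset.eq_empty_iff_forall_notMem]
      intro y hy
      simp only [levelLT, mem_filter, mem_univ, true_and] at hy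
      have := rank_eq y
      have := card_eq y
      omega
  have t1 : ((i : ℝ) - 2 * s) * (#(level n i) * w n i s)
      = ((#(level n i) : ℝ) * #(levelGE n (i + 1) (s + 1))
        - #(level n (i + 1)) * #(levelGE n i (s + 1))) / (#(levelEq n i s) * #(level n (i + 1))) := by
    unfold w
    split_ifs with h
    · rw [(g1 h).1, (g1 h).2]; simp
    · have : (i : ℝ) - 2 * s ≠ 0 := fun h' => h (by
        have : (i : ℝ) = 2 * s := by linarith
        exact_mod_cast this)
      field_simp
  have t2 : ((n : ℝ) - i + s) * (#(level n i) * w' n i s)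
      = ((#(level n i) : ℝ) * #(levelLT n (i + 1) (s + 1))
        - #(level n (i + 1)) * #(levelLT n i s)) / (#(levelEq n i s) * #(level n (i + 1))) := by
    unfold w'
    split_ifs with h
    · rw [(g2 h).1, (g2 h).2]; simp
    · have : (n : ℝ) - i + s ≠ 0 := fun h' => h (by
        have : (i : ℝ) = n + s := by linarith
        exact_mod_cast this)
      field_simp
  rw [t1, t2, ← add_div, div_eq_one_iff_eq (by positivity)]
  have c4 : (#(levelGE n i (s + 1)) : ℝ) = #(level n i) - #(levelLT n i s) - #(levelEq n i s) := by
    linarith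
  have c5 : (#(levelGE n (i + 1) (s + 1)) : ℝ)
      = #(level n (i + 1)) - #(levelLT n (i + 1) (s + 1)) := by linarith
  rw [c4, c5]
  ring

open Classical in
lemma stepProb_sum {n : ℕ} (x : Vec n) (hx : rank x < 2 * n) : ∑ y, stepProb x y = 1 := by
  have h0 : ∑ y, stepProb x y = ∑ y ∈ univ.filter (fun y : Vec n => x < y ∧ rank y = rank x + 1),
      if twos y = twos x + 1 then #(level n (rank x)) * w n (rank x) (twos x)
        else #(level n (rank x)) * w' n (rank x) (twos x) := by
    rw [Finset.sum_filter]; rfl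
  rw [h0, covers_eq, Finset.sum_image (fun a ha b hb => raise_injOn x (by simpa using ha)
    (by simpa using hb)), ← weights_sum x hx]
  have h1 : ∀ a ∈ (univ.filter fun a => x a ≠ 2),
      (if twos (raise x a) = twos x + 1 then #(level n (rank x)) * w n (rank x) (twos x)
        else #(level n (rank x)) * w' n (rank x) (twos x))
      = if x a = 1 then #(level n (rank x)) * w n (rank x) (twos x)
        else #(level n (rank x)) * w' n (rank x) (twos x) := by
    intro a ha
    rw [twos_raise (by simpa using ha)]
    by_cases h : x a = 1 <;> simp [h]
  rw [Finset.sum_congr rfl h1, Finset.sum_ite, Finset.sum_const, Finset.sum_const, nsmul_eq_mul,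
    nsmul_eq_mul, Finset.filter_filter, Finset.filter_filter]
  congr 4 <;>
  · ext a
    simp only [mem_filter, mem_univ, true_and]
    rcases fin3_cases (x a) with h | h | h <;> rw [h] <;> decide

/-- The distribution of the next element of the random chain after `x`. (Nothing comes after the
maximum `(2, …, 2)`; the value there is a convention that is never used below.) -/
noncomputable def step {n : ℕ} (x : Vec n) : PMF (Vec n) :=
  if hx : rank x < 2 * n then
    PMF.ofFintype (fun y => ENNReal.ofReal (stepProb x y)) (by
      rw [← ENNReal.ofReal_sum_of_nonneg fun y _ => stepProb_nonneg x y, stepProb_sum x hx,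
        ENNReal.ofReal_one])
  else PMF.pure x

/-- The random chain built up to level `m`, as the sequence of its elements: it starts at
`(0, …, 0)`, and it is extended from each level to the next by `step`, independently of the
earlier elements given the last one. -/
noncomputable def chainUpTo (n : ℕ) : (m : ℕ) → PMF (Fin (m + 1) → Vec n)
  | 0 => PMF.pure fun _ => 0
  | m + 1 => (chainUpTo n m).bind fun c => (step (c (Fin.last m))).map fun y => Fin.snoc c y

/-- The distribution `μ` on the maximal chains of `{0,1,2}^n`, a chain being given as the sequence
of its elements of ranks `0, 1, …, 2 n`. -/
noncomputable def chainMeasure (n : ℕ) : MeasureTheory.Measure (Fin (2 * n + 1) → Vec n) :=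
  (chainUpTo n (2 * n)).toMeasure

/-- The event that `x` belongs to the random chain. -/
def contains {n : ℕ} (x : Vec n) : Set (Fin (2 * n + 1) → Vec n) := {c | x ∈ Set.range c}

end Vec

/-! Complementing every coordinate and reversing time preserves the law of the chain
(`stepProb_compl`, `stepMat_pow_compl`). Hence an element of `L_i` is hit with probability `1/ℓ_i`,
and conditional hitting probabilities are entries of powers of the transition matrix. It remains to
go upwards from `x` to `y` with `rank x + rank y ≤ 2n`, where the corank `c` of `y` is at least `2k`
(`exists_forall_stepMat_pow_le`).

Everything rests on the weights being nearly independent of `s`: `ℓ_{i+1} w_{i,s}` is at most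
`2/(i+1)`, and at least `2/(i+1) - 3/n` when `i ≤ n` (`wNum_le`, `le_wNum`). So a step below the
middle has probability at most `2/n`, a step slightly above it at most `9/(4n)`, and near the top a
step fills an almost uniformly random one of the missing units. If steps have probability at most
`q`, then `m` steps lead to a given element with probability at most `m! q^m`
(`stepMat_pow_le_factorial`). The target bound is at least `k! (2/n)^k` and at least `1/n^k`.

If `y` is not above the middle, its last `k` steps suffice. If it is above and `rank x + k ≤ c`, a
given element of `L_c` is hit with probability at most `k! (2/n)^k`, and columns of the transition
matrix between the equally large levels `L_c` and `L_{2n-c}` sum to at most `1`. Otherwise `rank x`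
is within `k` of `c`. For `c` near `n`, short paths around the middle suffice. For `c` further down
but at least of order `√n`, spreading over `2k+2` steps beats the ratio of level sizes and gives
order `c^{-(2k+2)}`. For smaller `c`, a supermartingale tracking `2k` units missing from `y` gives
order `(c/n)^{2k}`. -/

namespace Vec

/-! ### Counting twos, and ratios of consecutive levels -/

/-- The total number of coordinates equal to `2` in the vectors of `L_i`. -/
noncomputable def sumTwos (n i : ℕ) : ℝ := ∑ s ∈ range (n + 1), (s : ℝ) * #(levelEq n i s)

lemma card_levelEq_eq_zero {n i s : ℕ} (h : n < s ∨ i < 2 * s ∨ n + s < i) :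
    #(levelEq n i s) = 0 := by
  rw [Finset.card_eq_zero, Finset.eq_empty_iff_forall_notMem]
  intro x hx
  obtain ⟨rfl, rfl⟩ : rank x = i ∧ twos x = s := by simpa [levelEq] using hx
  have := rank_eq x
  have := card_eq x
  omega

lemma levelLT_eq_level {n i : ℕ} : levelLT n i (n + 1) = level n i := by
  ext x
  have := twos_le x
  simp only [levelLT, level, mem_filter, mem_univ, true_and, and_iff_left_iff_imp]
  omega

lemma ell_eq_sum (n i : ℕ) : (ell n i : ℝ) = ∑ s ∈ range (n + 1), (#(levelEq n i s) : ℝ) := by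
  rw [ell, ← levelLT_eq_level, card_levelLT]; push_cast; rfl

lemma sumTwos_nonneg (n i : ℕ) : 0 ≤ sumTwos n i :=
  Finset.sum_nonneg fun _ _ => by positivity

/-- Double counting: a two of a vector in `L_{i+1}` comes from a one of a vector in `L_i`, and a
vector of rank `i` with `s` twos has `i - 2s` ones. -/
lemma sumTwos_succ (n i : ℕ) : sumTwos n (i + 1) = i * ell n i - 2 * sumTwos n i := by
  have h : sumTwos n (i + 1) = ∑ s ∈ range (n + 1), (#(levelEq n i s) : ℝ) * (i - 2 * s) := by
    rw [sumTwos, Finset.sum_range_succ', Finset.sum_range_succ]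
    have hn : (#(levelEq n i n) : ℝ) * (i - 2 * n) = 0 := by
      rw [← card_mul_succ, card_levelEq_eq_zero (Or.inl (Nat.lt_succ_self n))]; simp
    rw [hn]
    simp only [Nat.cast_zero, zero_mul, add_zero]
    refine Finset.sum_congr rfl fun s _ => ?_
    rw [← card_mul_succ]; push_cast; ring
  rw [h, ell_eq_sum, sumTwos, Finset.mul_sum, Finset.mul_sum, ← Finset.sum_sub_distrib]
  exact Finset.sum_congr rfl fun s _ => by ring

/-- The same double count for zeros turned into ones. -/
lemma succ_mul_ell_sub (n i : ℕ) :
    ((i : ℝ) + 1) * ell n (i + 1) - 2 * sumTwos n (i + 1) = (n - i) * ell n i + sumTwos n i := by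
  simp only [ell_eq_sum, sumTwos, Finset.mul_sum, ← Finset.sum_sub_distrib,
    ← Finset.sum_add_distrib]
  refine Finset.sum_congr rfl fun s _ => ?_
  linarith [card_mul_same n i s]

lemma succ_mul_ell_succ (n i : ℕ) :
    ((i : ℝ) + 1) * ell n (i + 1) = (n + i) * ell n i - 3 * sumTwos n i := by
  linarith [succ_mul_ell_sub n i, sumTwos_succ n i]

lemma succ_mul_ell_succ_le (n i : ℕ) :
    ((i : ℝ) + 1) * ell n (i + 1) ≤ (n + i) * ell n i := by
  linarith [succ_mul_ell_succ n i, sumTwos_nonneg n i]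

lemma sumTwos_eq_sum_levelGE (n i : ℕ) :
    sumTwos n i = ∑ s ∈ range (n + 2), (#(levelGE n i (s + 1)) : ℝ) := by
  have h : ∀ s ∈ range (n + 2), (#(levelGE n i (s + 1)) : ℝ)
      = ∑ q ∈ range (n + 2), if s < q then (#(levelEq n i q) : ℝ) else 0 := by
    intro s _
    rw [card_levelGE, ← Finset.sum_filter]
    push_cast
    refine Finset.sum_congr ?_ fun _ _ => rfl
    ext q; simp only [mem_Ico, mem_filter, mem_range]; omega
  rw [Finset.sum_congr rfl h, Finset.sum_comm, sumTwos, Finset.sum_range_succ _ (n + 1)]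
  have h0 : #(levelEq n i (n + 1)) = 0 := card_levelEq_eq_zero (by omega)
  simp only [h0, Nat.cast_zero, ite_self, Finset.sum_const_zero, add_zero]
  refine Finset.sum_congr rfl fun q hq => ?_
  rw [← Finset.sum_filter, Finset.sum_const, nsmul_eq_mul]
  congr 2
  have : (range (n + 2)).filter (fun s => s < q) = range q := by
    ext s; simp only [mem_filter, mem_range] at hq ⊢; omega
  rw [this, card_range]

/-- The average number of twos grows with the level: it is a sum of tail probabilities, and each
tail grows because the numerators of the `w_{i,s}` are non-negative. -/
lemma ell_mul_sumTwos_le (n i : ℕ) :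
    (ell n (i + 1) : ℝ) * sumTwos n i ≤ ell n i * sumTwos n (i + 1) := by
  rw [sumTwos_eq_sum_levelGE, sumTwos_eq_sum_levelGE, Finset.mul_sum, Finset.mul_sum]
  refine Finset.sum_le_sum fun s _ => ?_
  have := w_num_nonneg n i s
  simp only [ell]
  linarith

lemma two_mul_sumTwos_le (n i : ℕ) : 2 * sumTwos n i ≤ i * ell n i := by
  linarith [sumTwos_succ n i, sumTwos_nonneg n (i + 1)]

/-- Double counting of the covering pairs between `L_i` and `L_{i+1}`, combined with the fact that
the number of twos is stochastically increasing. -/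
lemma mul_ell_sub_le (n i : ℕ) :
    (ell n i : ℝ) * (n * ell n i - sumTwos n i)
      ≤ ell n (i + 1) * ((i + 1) * ell n i - sumTwos n i) := by
  nlinarith [ell_mul_sumTwos_le n i, succ_mul_ell_sub n i, sumTwos_succ n i]

lemma mul_ell_le_succ {n i : ℕ} (h : i < n) :
    (n : ℝ) * ell n i ≤ (i + 1) * ell n (i + 1) := by
  have h1 := mul_ell_sub_le n i
  have h2 := two_mul_sumTwos_le n i
  have h3 := sumTwos_nonneg n i
  have hn : (i : ℝ) + 1 ≤ n := by exact_mod_cast h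
  rcases (Nat.cast_nonneg (α := ℝ) (ell n i)).eq_or_lt with h0 | h0
  · rw [← h0, mul_zero]; positivity
  have hpos : 0 < n * (ell n i : ℝ) - sumTwos n i := by nlinarith
  have hB : (0 : ℝ) ≤ ell n (i + 1) := by positivity
  refine le_of_mul_le_mul_right ?_ hpos
  calc (n : ℝ) * ell n i * (n * ell n i - sumTwos n i)
      = n * (ell n i * (n * ell n i - sumTwos n i)) := by ring
    _ ≤ n * (ell n (i + 1) * ((i + 1) * ell n i - sumTwos n i)) := by gcongr
    _ ≤ (i + 1) * ell n (i + 1) * (n * ell n i - sumTwos n i) := by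
      have : (0 : ℝ) ≤ ell n (i + 1) * sumTwos n i := by positivity
      nlinarith

/-- With `A = ℓ_i` and `S` the number of twos in `L_i`, the slack in the last inequality is `ℓ_{i+1}
(i+1-n)(iA - 2S)`, non-negative because `iA - 2S` counts ones. -/
lemma mul_ell_le_of_le {n i : ℕ} (h : n ≤ i + 1) (h' : i < 2 * n) :
    (2 * (n : ℝ) - i) * ell n i ≤ (i + 2) * ell n (i + 1) := by
  have h1 := mul_ell_sub_le n i
  have h2 := two_mul_sumTwos_le n i
  have h3 := sumTwos_nonneg n i
  have hn : (n : ℝ) ≤ i + 1 := by exact_mod_cast h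
  have hn' : (i : ℝ) < 2 * n := by exact_mod_cast h'
  rcases (Nat.cast_nonneg (α := ℝ) (ell n i)).eq_or_lt with h0 | h0
  · rw [← h0, mul_zero]; positivity
  have hpos : 0 < n * (ell n i : ℝ) - sumTwos n i := by nlinarith
  have hB : (0 : ℝ) ≤ ell n (i + 1) := by positivity
  refine le_of_mul_le_mul_right ?_ hpos
  calc (2 * (n : ℝ) - i) * ell n i * (n * ell n i - sumTwos n i)
      = (2 * n - i) * (ell n i * (n * ell n i - sumTwos n i)) := by ring
    _ ≤ (2 * n - i) * (ell n (i + 1) * ((i + 1) * ell n i - sumTwos n i)) := by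
      have : (0 : ℝ) ≤ 2 * n - i := by linarith
      gcongr
    _ ≤ (i + 2) * ell n (i + 1) * (n * ell n i - sumTwos n i) := by
      have h5 : 0 ≤ (ell n (i + 1) : ℝ) * ((i + 1 - n) * (i * ell n i - 2 * sumTwos n i)) := by
        apply mul_nonneg hB (mul_nonneg (by linarith) (by linarith))
      nlinarith

/-! ### Partial sums of sequences with one sign change -/

/-- Once a term is positive all later ones are non-negative, so a partial sum containing a positive
term is the total `0` minus a non-negative tail. -/
lemma sum_range_nonpos_of_sign_change {δ : ℕ → ℝ} {N s : ℕ} (hs : s ≤ N)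
    (h0 : ∑ q ∈ range N, δ q = 0) (h : ∀ q r, q ≤ r → 0 < δ q → 0 ≤ δ r) :
    ∑ q ∈ range s, δ q ≤ 0 := by
  by_cases hc : ∀ q ∈ range s, δ q ≤ 0
  · exact Finset.sum_nonpos hc
  · push Not at hc
    obtain ⟨q, hq, hq'⟩ := hc
    rw [mem_range] at hq
    rw [← Finset.sum_range_add_sum_Ico _ hs] at h0
    have : 0 ≤ ∑ r ∈ Ico s N, δ r := Finset.sum_nonneg fun r hr => by
      rw [mem_Ico] at hr; exact h q r (by omega) hq'
    linarith

/-- Writes the number of covering pairs from `L_i^s` to `L_{i+1}^{s+1}` as a partial sum, to be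
compared termwise with `wNum_eq_sum`. -/
lemma sum_range_levelEq_telescope (n i s : ℕ) :
    ∑ q ∈ range (s + 1), ((#(levelEq n i q) : ℝ) * (i - 2 * q) - q * #(levelEq n (i + 1) q))
      = #(levelEq n i s) * (i - 2 * s) := by
  induction s with
  | zero => simp
  | succ s ih =>
    rw [Finset.sum_range_succ, ih, ← card_mul_succ]; push_cast; ring

/-! ### Two-sided bounds on the numerators of the weights -/

/-- The numerator of `w_{i,s}`. -/
noncomputable def wNum (n i s : ℕ) : ℝ :=
  (#(level n i) : ℝ) * #(levelGE n (i + 1) (s + 1)) - #(level n (i + 1)) * #(levelGE n i (s + 1))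

lemma wNum_eq_sub (n i s : ℕ) : wNum n i s = (ell n (i + 1) : ℝ) * #(levelLT n i (s + 1))
    - ell n i * #(levelLT n (i + 1) (s + 1)) := by
  rw [wNum]
  simp only [ell]
  rw [card_level n i (s + 1), card_level n (i + 1) (s + 1)]
  push_cast; ring

lemma wNum_eq_sum (n i s : ℕ) : wNum n i s = ∑ q ∈ range (s + 1),
    ((ell n (i + 1) : ℝ) * #(levelEq n i q) - ell n i * #(levelEq n (i + 1) q)) := by
  rw [wNum_eq_sub, card_levelLT, card_levelLT]
  push_cast
  rw [Finset.mul_sum, Finset.mul_sum, ← Finset.sum_sub_distrib]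

lemma wNum_nonneg (n i s : ℕ) : 0 ≤ wNum n i s := w_num_nonneg n i s

lemma wNum_self (n i : ℕ) : wNum n i n = 0 := by
  rw [wNum_eq_sub, levelLT_eq_level, levelLT_eq_level]
  simp only [ell]; ring

/-- The difference of the two sides is a partial sum of terms `|L_i^q|` times an increasing affine
function of `q`, with total `0` at `s = n`; so it has one sign change. -/
lemma wNum_le {n i s : ℕ} (hs : s ≤ n) :
    wNum n i s ≤ 2 * ell n i / (i + 1) * (#(levelEq n i s) * (i - 2 * s)) := by
  set c : ℝ := 2 * ell n i / (i + 1) with hc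
  have hi : (0 : ℝ) < i + 1 := by positivity
  have key : ∀ m, wNum n i m - c * (#(levelEq n i m) * (i - 2 * m)) = ∑ q ∈ range (m + 1),
      (#(levelEq n i q) : ℝ) * (ell n (i + 1) - ell n i / (i + 1) * (n + i - 3 * q)) := by
    intro m
    rw [wNum_eq_sum, ← sum_range_levelEq_telescope, Finset.mul_sum, ← Finset.sum_sub_distrib]
    refine Finset.sum_congr rfl fun q _ => ?_
    have h := card_mul_same n i q
    have h2 : (ell n i : ℝ) * #(levelEq n (i + 1) q) - c * (q * #(levelEq n (i + 1) q))
        = ell n i / (i + 1) * (#(levelEq n (i + 1) q) * (i + 1 - 2 * q)) := by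
      rw [hc]; field_simp
    rw [h] at h2
    have h3 : c = 2 * (ell n i / (i + 1)) := by rw [hc]; ring
    rw [h3] at h2 ⊢
    linear_combination -h2
  suffices wNum n i s - c * (#(levelEq n i s) * (i - 2 * s)) ≤ 0 by linarith
  rw [key]
  refine sum_range_nonpos_of_sign_change (N := n + 1) (by omega) ?_ fun q r hqr h => ?_
  · rw [← key, wNum_self, ← card_mul_succ, card_levelEq_eq_zero (Or.inl (Nat.lt_succ_self n))]
    simp
  · refine mul_nonneg (by positivity) ?_
    have h1 := (pos_of_mul_pos_right h (by positivity)).le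
    have hqr' : (q : ℝ) ≤ r := by exact_mod_cast hqr
    have : ell n i / (i + 1) * ((n : ℝ) + i - 3 * r) ≤ ell n i / (i + 1) * (n + i - 3 * q) := by
      gcongr
    linarith

lemma card_levelEq_zero_pos {n i : ℕ} (hi : i ≤ n) : 0 < #(levelEq n i 0) := by
  refine Finset.card_pos.2 ⟨fun a => if (a : ℕ) < i then 1 else 0, ?_⟩
  refine mem_filter.2 ⟨mem_univ _, ?_, ?_⟩
  · rw [rank]
    have : ∀ a : Fin n, ((if (a : ℕ) < i then 1 else 0 : Fin 3) : ℕ) = if (a : ℕ) < i then 1 else 0 := by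
      intro a; split_ifs <;> rfl
    rw [Finset.sum_congr rfl fun a _ => this a, Finset.sum_boole, Fin.card_filter_val_lt]
    simpa using hi
  · rw [twos, Finset.card_eq_zero, Finset.filter_eq_empty_iff]
    intro a _
    split_ifs <;> decide

/-- Again a single sign change, now against the constant that is exact at `s = 0`; that constant is
then bounded below. -/
lemma le_wNum {n i s : ℕ} (hs : s ≤ n) (hi : 1 ≤ i) (hin : i ≤ n) :
    (2 / (i + 1) - 3 / n) * ell n i * (#(levelEq n i s) * (i - 2 * s)) ≤ wNum n i s := by
  have hi0 : (0 : ℝ) < i := by exact_mod_cast hi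
  have hn0 : (0 : ℝ) < n := by exact_mod_cast (by omega : 0 < n)
  set A : ℝ := (ell n i : ℝ) with hA
  set B : ℝ := (ell n (i + 1) : ℝ) with hB
  -- This value makes the term at `q = 0` vanish, which is what lets the factor `q` split off in
  -- `quad`.
  set c : ℝ := (B * (i + 1) - A * (n - i)) / (i * (i + 1)) with hc
  have hc' : c * (i * (i + 1)) = B * (i + 1) - A * (n - i) := by
    rw [hc]; field_simp
  have ha0 : (0 : ℝ) < #(levelEq n i 0) := by exact_mod_cast card_levelEq_zero_pos hin
  have hD0 : wNum n i 0 = c * (#(levelEq n i 0) * i) := by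
    have := card_mul_same n i 0
    rw [wNum_eq_sum]
    simp only [zero_add, range_one, sum_singleton]
    rw [← hA, ← hB]
    push_cast at this
    have e : (#(levelEq n (i + 1) 0) : ℝ) = #(levelEq n i 0) * (n - i) / (i + 1) := by
      field_simp; linarith
    rw [e, hc]; field_simp
  have hc0 : 0 ≤ c := by
    have := wNum_nonneg n i 0
    rw [hD0] at this
    exact nonneg_of_mul_nonneg_left this (by positivity)
  have hc1 : c ≤ 2 * A / (i + 1) := by
    have := wNum_le (n := n) (i := i) (s := 0) (Nat.zero_le n)
    rw [hD0] at this
    push_cast at this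
    rw [mul_zero, sub_zero] at this
    exact le_of_mul_le_mul_right this (by positivity)
  -- By the level recursion `c i(i+1) = 2iA - 3S` with `S` the number of twos in `L_i`; here `S ≤
  -- (i-1) ℓ_{i-1} ≤ (i-1) i A / n`.
  have hc2 : (2 / (i + 1) - 3 / n) * A ≤ c := by
    obtain ⟨m, rfl⟩ : ∃ m, i = m + 1 := ⟨i - 1, by omega⟩
    have h1 := sumTwos_succ n m
    have h2 := sumTwos_nonneg n m
    have h3 := mul_ell_le_succ (n := n) (i := m) (by omega)
    have h4 := succ_mul_ell_succ n (m + 1)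
    rw [← hA] at h3 h4
    rw [← hB] at h4
    have h5 : sumTwos n (m + 1) ≤ m * ((m + 1) * A / n) := by
      have : (ell n m : ℝ) ≤ (m + 1) * A / n := by rw [le_div_iff₀ hn0]; linarith
      calc sumTwos n (m + 1) ≤ m * ell n m := by linarith
        _ ≤ _ := by gcongr
    push_cast at *
    have h6 : c = (2 * (m + 1) * A - 3 * sumTwos n (m + 1)) / ((m + 1) * (m + 1 + 1)) := by
      rw [hc]; congr 1; linarith
    rw [h6, le_div_iff₀ (by positivity)]
    have e1 : (2 / ((m : ℝ) + 1 + 1) - 3 / n) * A * ((m + 1) * (m + 1 + 1))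
        = 2 * (m + 1) * A - 3 * ((m + 2) * ((m + 1) * A / n)) := by field_simp; ring
    rw [e1]
    have : (0 : ℝ) ≤ (m + 1) * A / n := by positivity
    nlinarith
  have hx0 : 0 ≤ (#(levelEq n i s) : ℝ) * (i - 2 * s) := by
    rw [← card_mul_succ]; positivity
  suffices c * (#(levelEq n i s) * (i - 2 * s)) - wNum n i s ≤ 0 by
    linarith [mul_le_mul_of_nonneg_right hc2 hx0]
  have key : ∀ m, c * (#(levelEq n i m) * (i - 2 * m)) - wNum n i m = ∑ q ∈ range (m + 1),
      (c * (#(levelEq n i q) * (i - 2 * q)) - B * #(levelEq n i q)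
        + (A - c * q) * #(levelEq n (i + 1) q)) := by
    intro m
    rw [wNum_eq_sum, ← sum_range_levelEq_telescope, Finset.mul_sum, ← Finset.sum_sub_distrib]
    exact Finset.sum_congr rfl fun q _ => by ring
  rw [key]
  set β : ℝ := -2 * c * (2 * i + 1) + 2 * B + A - c * (n - i) with hβ
  -- After clearing `i + 1 - 2q` the term is `|L_i^q| q` times an affine function of slope `3c ≥ 0`,
  -- so positivity persists.
  have quad : ∀ q : ℕ, (c * (#(levelEq n i q) * (i - 2 * q)) - B * #(levelEq n i q)
        + (A - c * q) * #(levelEq n (i + 1) q)) * (i + 1 - 2 * q)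
      = #(levelEq n i q) * (q * (3 * c * q + β)) := by
    intro q
    have h := card_mul_same n i q
    have h2 : (A - c * q) * #(levelEq n (i + 1) q) * (i + 1 - 2 * q)
      = (A - c * q) * (#(levelEq n i q) * (n - i + q)) := by rw [← h]; ring
    rw [hβ]
    linear_combination h2 + #(levelEq n i q) * hc'
  refine sum_range_nonpos_of_sign_change (N := n + 1) (by omega) ?_ fun q r hqr h => ?_
  · rw [← key, wNum_self, ← card_mul_succ, card_levelEq_eq_zero (Or.inl (Nat.lt_succ_self n))]
    simp
  · rcases lt_trichotomy (2 * r) (i + 1) with hr | hr | hr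
    · have hr' : (0 : ℝ) < i + 1 - 2 * r := by
        have : (2 * r : ℝ) < i + 1 := by exact_mod_cast hr
        linarith
      have hqr' : (q : ℝ) ≤ r := by exact_mod_cast hqr
      have hq := mul_pos h (by linarith : (0 : ℝ) < i + 1 - 2 * q)
      rw [quad] at hq
      have h1 := pos_of_mul_pos_right hq (by positivity)
      have h2 := pos_of_mul_pos_right h1 (by positivity)
      refine nonneg_of_mul_nonneg_left ?_ hr'
      rw [quad]
      have : 0 ≤ 3 * c * r + β := by nlinarith
      positivity
    -- Here the multiplier `i + 1 - 2r` vanishes and `quad` says nothing. `L_i^r` is empty, and the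
    -- remaining part is non-negative because `c ≤ 2A/(i+1)`.
    · rw [card_levelEq_eq_zero (i := i) (s := r) (by omega)]
      have hr' : (r : ℝ) = (i + 1) / 2 := by
        have : (2 * r : ℝ) = i + 1 := by exact_mod_cast hr
        linarith
      have : c * r ≤ A := by
        rw [hr']
        calc c * (((i : ℝ) + 1) / 2) ≤ 2 * A / (i + 1) * ((i + 1) / 2) := by gcongr
          _ = A := by field_simp
      have : 0 ≤ (A - c * r) * #(levelEq n (i + 1) r) := mul_nonneg (by linarith) (by positivity)
      simpa using this
    · rw [card_levelEq_eq_zero (i := i) (s := r) (by omega),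
        card_levelEq_eq_zero (i := i + 1) (s := r) (by omega)]
      simp

/-! ### Complementation -/

/-- The complement of a vector: every coordinate `v` is replaced by `2 - v`. -/
def compl {n : ℕ} (x : Vec n) : Vec n := fun a => (x a).rev

@[simp] lemma compl_compl {n : ℕ} (x : Vec n) : compl (compl x) = x := by
  funext a; simp [compl]

/-- Complementation as a permutation. -/
def complEquiv (n : ℕ) : Vec n ≃ Vec n := ⟨compl, compl, compl_compl, compl_compl⟩

lemma compl_le_compl {n : ℕ} {x y : Vec n} : compl x ≤ compl y ↔ y ≤ x := by
  simp [Pi.le_def, compl, Fin.rev_le_rev]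

lemma compl_lt_compl {n : ℕ} {x y : Vec n} : compl x < compl y ↔ y < x := by
  rw [lt_iff_le_not_ge, lt_iff_le_not_ge, compl_le_compl, compl_le_compl]

lemma rank_add_rank_compl {n : ℕ} (x : Vec n) : rank x + rank (compl x) = 2 * n := by
  rw [rank, rank, ← Finset.sum_add_distrib]
  have : ∀ a, ((x a : ℕ) + (compl x a : ℕ)) = 2 := by
    intro a
    have := (x a).isLt
    simp only [compl, Fin.val_rev]; omega
  simp [this, mul_comm]

lemma rank_le {n : ℕ} (x : Vec n) : rank x ≤ 2 * n := by
  have := rank_add_rank_compl x; omega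

lemma twos_compl_add_rank {n : ℕ} (x : Vec n) : twos (compl x) + rank x = n + twos x := by
  have h1 := rank_eq x
  have h2 := card_eq x
  have h3 : twos (compl x) = #{a | x a = 0} := by
    rw [twos]
    refine congrArg card (Finset.filter_congr fun a _ => ?_)
    rw [compl]
    rcases fin3_cases (x a) with h | h | h <;> rw [h] <;> decide
  omega

lemma card_filter_compl {n : ℕ} (p q : Vec n → Prop) [DecidablePred p] [DecidablePred q]
    (h : ∀ x, p (compl x) ↔ q x) : #{x | p x} = #{x | q x} := by
  refine Finset.card_bij' (fun x _ => compl x) (fun x _ => compl x) ?_ ?_ ?_ ?_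
  · intro x hx
    simp only [mem_filter, mem_univ, true_and] at hx ⊢
    rw [← h, compl_compl]; exact hx
  · intro x hx
    simp only [mem_filter, mem_univ, true_and] at hx ⊢
    rw [h]; exact hx
  · simp
  · simp

lemma ell_compl {n i i' : ℕ} (h : i + i' = 2 * n) : ell n i' = ell n i := by
  refine card_filter_compl _ _ fun x => ?_
  have := rank_add_rank_compl x; omega

lemma card_levelEq_compl {n i i' s s' : ℕ} (h : i + i' = 2 * n) (hs : s' + i = n + s) :
    #(levelEq n i' s') = #(levelEq n i s) := by
  refine card_filter_compl _ _ fun x => ?_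
  have := rank_add_rank_compl x
  have := twos_compl_add_rank x
  omega

lemma card_levelLT_compl {n i i' s s' : ℕ} (h : i + i' = 2 * n) (hs : s' + i = n + s) :
    #(levelLT n i' s') = #(levelLT n i s) := by
  refine card_filter_compl _ _ fun x => ?_
  have := rank_add_rank_compl x
  have := twos_compl_add_rank x
  omega

lemma ell_rank_pos {n : ℕ} (x : Vec n) : 0 < (ell n (rank x) : ℝ) := by
  exact_mod_cast Finset.card_pos.2 ⟨x, by simp [level]⟩

lemma ell_pos {n i : ℕ} (hi : i ≤ 2 * n) : 0 < (ell n i : ℝ) := by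
  have low : ∀ m ≤ n, 0 < (ell n m : ℝ) := fun m hm => by
    obtain ⟨x, hx⟩ := Finset.card_pos.1 (card_levelEq_zero_pos hm)
    exact_mod_cast Finset.card_pos.2 ⟨x, by
      simp only [levelEq, level, mem_filter, mem_univ, true_and] at hx ⊢; exact hx.1⟩
  rcases le_total i n with h | h
  · exact low i h
  · rw [ell_compl (i := 2 * n - i) (by omega)]; exact low _ (by omega)

/-! ### Bounds on the weights -/

lemma w_eq {n i s : ℕ} (h : i ≠ 2 * s) : w n i s =
    wNum n i s / (#(levelEq n i s) * ell n i * ell n (i + 1) * ((i : ℝ) - 2 * s)) := by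
  rw [w, if_neg h]; rfl

/-- Complementation turns a step from `0` to `1`, read backwards, into a step from `1` to `2`, so
bounds on `w` transfer to `w'`. -/
lemma w'_compl {n i s i' s' : ℕ} (h : i ≠ 2 * s) (hi : i + i' + 1 = 2 * n)
    (hs : s' + i = n + s) : w' n i' s' = w n i s := by
  have e1 : ell n i' = ell n (i + 1) := ell_compl (by omega)
  have e2 : ell n (i' + 1) = ell n i := ell_compl (by omega)
  rw [w_eq h, w', if_neg (by omega), wNum_eq_sub,
    card_levelLT_compl (i := i) (i' := i' + 1) (s := s + 1) (s' := s' + 1) (by omega) (by omega),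
    card_levelLT_compl (i := i + 1) (i' := i') (s := s + 1) (s' := s') (by omega) (by omega),
    card_levelEq_compl (i := i + 1) (i' := i') (s := s + 1) (s' := s') (by omega) (by omega)]
  change ((ell n i' : ℝ) * _ - ell n (i' + 1) * _) / (_ * ell n i' * ell n (i' + 1) * _) = _
  rw [e1, e2]
  have h1 : (i : ℝ) + i' + 1 = 2 * n := by exact_mod_cast hi
  have h2 : (s' : ℝ) + i = n + s := by exact_mod_cast hs
  congr 1
  have h3 := card_mul_succ n i s
  have h4 : (n : ℝ) - i' + s' = s + 1 := by linarith
  rw [h4]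
  linear_combination (ell n i : ℝ) * ell n (i + 1) * h3

lemma ell_succ_mul_w_le {n : ℕ} {x : Vec n} (hx : rank x ≠ 2 * twos x) :
    ell n (rank x + 1) * w n (rank x) (twos x) ≤ 2 / (rank x + 1) := by
  have h1 := ell_rank_pos x
  have h2 : (0 : ℝ) < #(levelEq n (rank x) (twos x)) := by
    exact_mod_cast Finset.card_pos.2 ⟨x, mem_levelEq_self x⟩
  have h3 : 0 < (rank x : ℝ) - 2 * twos x := by
    have := rank_eq x
    have : 2 * twos x < rank x := by omega
    have : (2 * twos x : ℝ) < rank x := by exact_mod_cast this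
    linarith
  have h4 := wNum_le (n := n) (i := rank x) (twos_le x)
  rw [w_eq hx]
  rcases (Nat.cast_nonneg (α := ℝ) (ell n (rank x + 1))).eq_or_lt with h0 | h0
  · rw [← h0, zero_mul]; positivity
  calc _ = wNum n (rank x) (twos x) /
        (ell n (rank x) * (#(levelEq n (rank x) (twos x)) * (rank x - 2 * twos x))) := by
        field_simp
    _ ≤ _ := by
        rw [div_le_iff₀ (by positivity)]
        calc _ ≤ _ := h4
          _ = _ := by ring

lemma le_ell_succ_mul_w {n : ℕ} {x : Vec n} (hx : rank x ≠ 2 * twos x) (hn : rank x ≤ n) :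
    2 / (rank x + 1) - 3 / n ≤ ell n (rank x + 1) * w n (rank x) (twos x) := by
  have h1 := ell_rank_pos x
  have h2 : (0 : ℝ) < #(levelEq n (rank x) (twos x)) := by
    exact_mod_cast Finset.card_pos.2 ⟨x, mem_levelEq_self x⟩
  have hr := rank_eq x
  have h3 : 0 < (rank x : ℝ) - 2 * twos x := by
    have : 2 * twos x < rank x := by omega
    have : (2 * twos x : ℝ) < rank x := by exact_mod_cast this
    linarith
  have h4 := le_wNum (n := n) (i := rank x) (twos_le x) (by omega) hn
  rw [w_eq hx]
  have h0 : 0 < (ell n (rank x + 1) : ℝ) := ell_pos (by omega)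
  calc _ ≤ wNum n (rank x) (twos x) /
        (ell n (rank x) * (#(levelEq n (rank x) (twos x)) * (rank x - 2 * twos x))) := by
        rw [le_div_iff₀ (by positivity)]
        calc _ = _ := by ring
          _ ≤ _ := h4
    _ = _ := by field_simp

/-! ### The transition probabilities -/

lemma exists_raise_of_cover {n : ℕ} {x y : Vec n} (h : x < y) (hr : rank y = rank x + 1) :
    ∃ a, x a ≠ 2 ∧ raise x a = y := by
  classical
  have : y ∈ univ.filter fun y : Vec n => x < y ∧ rank y = rank x + 1 := by simp [h, hr]
  rw [covers_eq] at this
  simpa using this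

lemma stepProb_eq_zero {n : ℕ} {x y : Vec n} (h : ¬ (x < y ∧ rank y = rank x + 1)) :
    stepProb x y = 0 := by
  unfold stepProb; rw [if_neg h]

lemma twos_of_cover {n : ℕ} {x y : Vec n} (h : x < y) (hr : rank y = rank x + 1) :
    (twos y = twos x + 1 ∧ rank x ≠ 2 * twos x) ∨ (twos y = twos x) := by
  obtain ⟨a, ha, rfl⟩ := exists_raise_of_cover h hr
  rw [twos_raise ha]
  by_cases h1 : x a = 1
  · left
    refine ⟨by simp [h1], ?_⟩
    have : 0 < #{a | x a = 1} := Finset.card_pos.2 ⟨a, by simp [h1]⟩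
    have := rank_eq x
    omega
  · right; simp [h1]

lemma stepProb_one {n : ℕ} {x y : Vec n} (h : x < y) (hr : rank y = rank x + 1)
    (ht : twos y = twos x + 1) : stepProb x y = ell n (rank x) * w n (rank x) (twos x) := by
  unfold stepProb; rw [if_pos ⟨h, hr⟩, if_pos ht]; rfl

lemma stepProb_zero {n : ℕ} {x y : Vec n} (h : x < y) (hr : rank y = rank x + 1)
    (ht : twos y = twos x) : stepProb x y = ell n (rank x) * w' n (rank x) (twos x) := by
  unfold stepProb; rw [if_pos ⟨h, hr⟩, if_neg (by omega)]; rfl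

/-- After division by level sizes this is an equality of probabilities of consecutive pairs: the
chain is invariant under complementation combined with time reversal. -/
lemma stepProb_compl {n : ℕ} (x y : Vec n) : stepProb (compl y) (compl x) / ell n (rank y)
    = stepProb x y / ell n (rank x) := by
  by_cases h : x < y ∧ rank y = rank x + 1
  · obtain ⟨h, hr⟩ := h
    have rx := rank_add_rank_compl x
    have ry := rank_add_rank_compl y
    have tx := twos_compl_add_rank x
    have ty := twos_compl_add_rank y
    have hc : compl y < compl x := compl_lt_compl.2 h
    have lx := ell_rank_pos x
    have ly := ell_rank_pos y
    have ey : ell n (rank (compl y)) = ell n (rank y) := ell_compl ry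
    rcases twos_of_cover h hr with ⟨ht, hne⟩ | ht
    · rw [stepProb_one h hr ht, stepProb_zero hc (by omega) (by omega), ey,
        w'_compl hne (by omega) (by omega)]
      field_simp
    · have hc' := twos_of_cover hc (by omega)
      have hne : rank (compl y) ≠ 2 * twos (compl y) := by omega
      rw [stepProb_zero h hr ht, stepProb_one hc (by omega) (by omega), ey,
        w'_compl (i' := rank x) (s' := twos x) hne (by omega) (by omega)]
      field_simp
  · rw [stepProb_eq_zero h, stepProb_eq_zero, zero_div, zero_div]
    rw [compl_lt_compl]
    have := rank_add_rank_compl x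
    have := rank_add_rank_compl y
    exact fun hc => h ⟨hc.1, by omega⟩

/-- The probability of a step that turns a `1` into a `2`. -/
lemma stepProb_one_le {n : ℕ} {x y : Vec n} (h : x < y) (hr : rank y = rank x + 1)
    (ht : twos y = twos x + 1) :
    stepProb x y * ell n (rank x + 1) ≤ 2 / (rank x + 1) * ell n (rank x) := by
  have hne : rank x ≠ 2 * twos x := by
    rcases twos_of_cover h hr with h | h
    · exact h.2
    · omega
  have := mul_le_mul_of_nonneg_right (ell_succ_mul_w_le hne) (ell_rank_pos x).le
  rw [stepProb_one h hr ht]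
  linarith

lemma stepProb_zero_eq {n : ℕ} {x y : Vec n} (h : x < y) (hr : rank y = rank x + 1)
    (ht : twos y = twos x) : stepProb x y
      = ell n (rank (compl y) + 1) * w n (rank (compl y)) (twos (compl y)) := by
  have rx := rank_add_rank_compl x
  have ry := rank_add_rank_compl y
  have tx := twos_compl_add_rank x
  have ty := twos_compl_add_rank y
  have hc' := twos_of_cover (compl_lt_compl.2 h) (by omega)
  rw [stepProb_zero h hr ht, w'_compl (i := rank (compl y)) (s := twos (compl y))
    (by omega) (by omega) (by omega), ell_compl (i := rank (compl y) + 1) (by omega)]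

/-- The probability of a step that turns a `0` into a `1`. -/
lemma stepProb_zero_le {n : ℕ} {x y : Vec n} (h : x < y) (hr : rank y = rank x + 1)
    (ht : twos y = twos x) : stepProb x y ≤ 2 / (2 * n - rank x) := by
  have rx := rank_add_rank_compl x
  have ry := rank_add_rank_compl y
  have tx := twos_compl_add_rank x
  have ty := twos_compl_add_rank y
  have hc' := twos_of_cover (compl_lt_compl.2 h) (by omega)
  rw [stepProb_zero_eq h hr ht]
  have hne : rank (compl y) ≠ 2 * twos (compl y) := by omega
  have h1 := ell_succ_mul_w_le hne
  have h2 : (rank y : ℝ) + rank (compl y) = 2 * n := by exact_mod_cast ry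
  have h3 : (rank y : ℝ) = rank x + 1 := by exact_mod_cast hr
  rwa [show (rank (compl y) : ℝ) + 1 = 2 * n - rank x by linarith] at h1

/-- Near the top, a step raises the coordinate `a` with probability about `(2 - x a) / r`, where
`r` is the corank. -/
lemma le_stepProb_raise {n : ℕ} {x : Vec n} {a : Fin n} (ha : x a ≠ 2) (hn : n ≤ rank x) :
    (2 - (x a : ℕ) : ℝ) * (1 / (2 * n - rank x) - 3 / (2 * n)) ≤ stepProb x (raise x a) := by
  have hlt := lt_raise ha
  have hr := rank_raise ha
  have ht := twos_raise ha
  have hle := rank_le (raise x a)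
  have hr0 : (0 : ℝ) < 2 * n - rank x := by
    have : rank x < 2 * n := by omega
    have : (rank x : ℝ) < 2 * n := by exact_mod_cast this
    linarith
  have hn0 : (0 : ℝ) < n := by exact_mod_cast a.pos
  rcases fin3_cases (x a) with h | h | h
  · rw [if_neg (by rw [h]; decide)] at ht
    rw [stepProb_zero_eq hlt hr ht]
    have ry := rank_add_rank_compl (raise x a)
    have tx := twos_compl_add_rank x
    have rx := rank_add_rank_compl x
    have ty := twos_compl_add_rank (raise x a)
    have hc' := twos_of_cover (compl_lt_compl.2 hlt) (by omega)
    have h1 := le_ell_succ_mul_w (x := compl (raise x a)) (by omega) (by omega)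
    have h2 : (rank (raise x a) : ℝ) + rank (compl (raise x a)) = 2 * n := by exact_mod_cast ry
    have h3 : (rank (raise x a) : ℝ) = rank x + 1 := by exact_mod_cast hr
    rw [show (rank (compl (raise x a)) : ℝ) + 1 = 2 * n - rank x by linarith] at h1
    refine le_trans (le_of_eq ?_) h1
    rw [h]; simp; ring
  · rw [if_pos h] at ht
    have hsum := weights_sum x (by omega)
    have hones := ones_real (mem_levelEq_self x)
    have hzeros := zeros_real (mem_levelEq_self x)
    have hp : 0 < #{a | x a = 1} := Finset.card_pos.2 ⟨a, by simp [h]⟩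
    -- Steps from `0` to `1` have probability at most `2/r` each, where `r = #ones + 2 #zeros` is
    -- the corank. As the total is `1`, steps from `1` to `2` are left with at least `1/r` each.
    have hz : (#{a | x a = 0} : ℝ) * (#(level n (rank x)) * w' n (rank x) (twos x))
        ≤ #{a | x a = 0} * (2 / (2 * n - rank x)) := by
      rcases Nat.eq_zero_or_pos #{a | x a = 0} with h0 | h0
      · rw [h0]; simp
      · obtain ⟨b, hb⟩ := Finset.card_pos.1 h0
        rw [mem_filter] at hb
        have hb2 : x b ≠ 2 := by rw [hb.2]; decide
        have htb := twos_raise hb2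
        rw [if_neg (by rw [hb.2]; decide)] at htb
        have h1 := stepProb_zero_le (lt_raise hb2) (rank_raise hb2) htb
        rw [stepProb_zero (lt_raise hb2) (rank_raise hb2) htb] at h1
        exact mul_le_mul_of_nonneg_left h1 (by positivity)
    have hp' : (0 : ℝ) < #{a | x a = 1} := by exact_mod_cast hp
    rw [stepProb_one hlt hr ht]
    have h2 : 1 / (2 * n - rank x : ℝ) ≤ ell n (rank x) * w n (rank x) (twos x) := by
      refine le_of_mul_le_mul_left ?_ hp'
      have e : (#{a | x a = 1} : ℝ) * (1 / (2 * n - rank x))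
          = 1 - #{a | x a = 0} * (2 / (2 * n - rank x)) := by
        rw [hones, hzeros]; field_simp; ring
      rw [e]
      simp only [ell]
      linarith
    have h3 : (0 : ℝ) ≤ 3 / (2 * n) := by positivity
    rw [h]
    norm_num at h2 ⊢
    linarith
  · exact absurd h ha

lemma stepProb_le_of_lt {n : ℕ} (x y : Vec n) (hx : rank x < n) : stepProb x y ≤ 2 / n := by
  have hn : (0 : ℝ) < n := by exact_mod_cast (by omega : 0 < n)
  by_cases h : x < y ∧ rank y = rank x + 1
  · obtain ⟨h, hr⟩ := h
    have hx' : (rank x : ℝ) < n := by exact_mod_cast hx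
    rcases twos_of_cover h hr with ⟨ht, -⟩ | ht
    · have h1 := stepProb_one_le h hr ht
      have h2 := mul_ell_le_succ hx
      have h3 : 0 < (ell n (rank x + 1) : ℝ) := ell_pos (by omega)
      refine le_of_mul_le_mul_right (h1.trans ?_) h3
      rw [div_mul_eq_mul_div, div_mul_eq_mul_div, div_le_div_iff₀ (by positivity) hn]
      linarith
    · exact (stepProb_zero_le h hr ht).trans (by gcongr; linarith)
  · rw [stepProb_eq_zero h]; positivity

lemma stepProb_le_of_le {n : ℕ} (x y : Vec n) (hx : n ≤ rank x + 1) (hx' : rank x < 2 * n) :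
    stepProb x y ≤ 2 * (rank x + 2) / ((rank x + 1) * (2 * n - rank x)) := by
  have hr0 : (0 : ℝ) < 2 * n - rank x := by
    have : (rank x : ℝ) < 2 * n := by exact_mod_cast hx'
    linarith
  by_cases h : x < y ∧ rank y = rank x + 1
  · obtain ⟨h, hr⟩ := h
    rcases twos_of_cover h hr with ⟨ht, -⟩ | ht
    · have h1 := stepProb_one_le h hr ht
      have h2 := mul_ell_le_of_le hx hx'
      have h3 : 0 < (ell n (rank x + 1) : ℝ) := ell_pos (by omega)
      refine le_of_mul_le_mul_right (h1.trans ?_) h3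
      rw [div_mul_eq_mul_div, div_mul_eq_mul_div, div_le_div_iff₀ (by positivity) (by positivity)]
      have : (0 : ℝ) ≤ 2 * (rank x + 1) := by positivity
      nlinarith
    · refine (stepProb_zero_le h hr ht).trans ?_
      rw [div_le_div_iff₀ hr0 (by positivity)]
      nlinarith
  · rw [stepProb_eq_zero h]; positivity

/-! ### The transition matrix -/

/-- The matrix of the transition probabilities. -/
noncomputable def stepMat (n : ℕ) : Matrix (Vec n) (Vec n) ℝ := Matrix.of stepProb

lemma stepMat_pow_nonneg {n : ℕ} (m : ℕ) (x y : Vec n) : 0 ≤ (stepMat n ^ m) x y := by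
  induction m generalizing x with
  | zero => rw [pow_zero, Matrix.one_apply]; split_ifs <;> norm_num
  | succ m ih =>
    rw [pow_succ', Matrix.mul_apply]
    exact Finset.sum_nonneg fun z _ => mul_nonneg (stepProb_nonneg x z) (ih z)

lemma stepMat_pow_add {n : ℕ} (a b : ℕ) (x y : Vec n) :
    (stepMat n ^ (a + b)) x y = ∑ z, (stepMat n ^ a) x z * (stepMat n ^ b) z y := by
  rw [pow_add, Matrix.mul_apply]

lemma stepMat_pow_succ {n : ℕ} (m : ℕ) (x y : Vec n) :
    (stepMat n ^ (m + 1)) x y = ∑ z, (stepMat n ^ m) x z * stepProb z y := by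
  rw [pow_succ, Matrix.mul_apply]; rfl

lemma stepMat_pow_succ' {n : ℕ} (m : ℕ) (x y : Vec n) :
    (stepMat n ^ (m + 1)) x y = ∑ z, stepProb x z * (stepMat n ^ m) z y := by
  rw [pow_succ', Matrix.mul_apply]; rfl

lemma rank_of_stepMat_pow_ne_zero {n m : ℕ} {x y : Vec n} (h : (stepMat n ^ m) x y ≠ 0) :
    x ≤ y ∧ rank y = rank x + m := by
  induction m generalizing x with
  | zero =>
    rw [pow_zero, Matrix.one_apply] at h
    have : x = y := by by_contra hne; simp [hne] at h
    subst this; exact ⟨le_rfl, rfl⟩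
  | succ m ih =>
    rw [stepMat_pow_succ'] at h
    obtain ⟨z, -, hz⟩ := Finset.exists_ne_zero_of_sum_ne_zero h
    have h1 : x < z ∧ rank z = rank x + 1 := by
      by_contra hc
      exact hz (by rw [stepProb_eq_zero hc, zero_mul])
    have h2 := ih (right_ne_zero_of_mul hz)
    exact ⟨h1.1.le.trans h2.1, by omega⟩

lemma stepProb_sum_le {n : ℕ} (x : Vec n) : ∑ y, stepProb x y ≤ 1 := by
  rcases (rank_le x).lt_or_eq with h | h
  · exact (stepProb_sum x h).le
  · rw [Finset.sum_eq_zero fun y _ => stepProb_eq_zero fun hy => ?_]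
    · exact zero_le_one
    · have := rank_le y; omega

lemma stepMat_pow_sum_le {n : ℕ} (m : ℕ) (x : Vec n) : ∑ y, (stepMat n ^ m) x y ≤ 1 := by
  induction m generalizing x with
  | zero => simp [Matrix.one_apply]
  | succ m ih =>
    simp only [stepMat_pow_succ']
    rw [Finset.sum_comm]
    simp only [← Finset.mul_sum]
    calc _ ≤ ∑ z, stepProb x z * 1 := by
          gcongr with z
          · exact stepProb_nonneg x z
          · exact ih z
      _ ≤ 1 := by simpa using stepProb_sum_le x

lemma stepMat_pow_sum {n : ℕ} (m : ℕ) (x : Vec n) (h : rank x + m ≤ 2 * n) :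
    ∑ y, (stepMat n ^ m) x y = 1 := by
  induction m generalizing x with
  | zero => simp [Matrix.one_apply]
  | succ m ih =>
    simp only [stepMat_pow_succ']
    rw [Finset.sum_comm]
    simp only [← Finset.mul_sum]
    rw [← stepProb_sum x (by omega)]
    refine Finset.sum_congr rfl fun z _ => ?_
    by_cases hz : x < z ∧ rank z = rank x + 1
    · rw [ih z (by omega), mul_one]
    · rw [stepProb_eq_zero hz, zero_mul]

lemma sum_compl {n : ℕ} (f : Vec n → ℝ) : ∑ x, f (compl x) = ∑ x, f x :=
  (complEquiv n).sum_comp f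

lemma stepMat_pow_compl {n : ℕ} (m : ℕ) (x y : Vec n) :
    (stepMat n ^ m) (compl y) (compl x) / ell n (rank y)
      = (stepMat n ^ m) x y / ell n (rank x) := by
  induction m generalizing x with
  | zero =>
    simp only [pow_zero, Matrix.one_apply]
    by_cases h : x = y
    · subst h; simp
    · have : compl y ≠ compl x := fun hc => h (by
        rw [← compl_compl x, ← hc, compl_compl])
      simp [h, this]
  | succ m ih =>
    rw [stepMat_pow_succ, stepMat_pow_succ', Finset.sum_div, Finset.sum_div, ← sum_compl]
    refine Finset.sum_congr rfl fun z _ => ?_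
    have h1 := ih z
    have h2 := stepProb_compl x z
    have hz := (ell_rank_pos z).ne'
    have hx := (ell_rank_pos x).ne'
    have hy := (ell_rank_pos y).ne'
    rw [div_eq_div_iff hy hz] at h1
    rw [div_eq_div_iff hz hx] at h2
    rw [div_eq_div_iff hy hx]
    refine mul_left_cancel₀ hz ?_
    linear_combination (stepProb (compl z) (compl x) * (ell n (rank x) : ℝ)) * h1
      + (stepMat n ^ m) z y * (ell n (rank y) : ℝ) * h2

/-- Reversal turns a column sum into a row sum times a ratio of level sizes. -/
lemma sum_stepMat_pow_left_le {n m : ℕ} (y : Vec n) (h : m ≤ rank y) :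
    ∑ z, (stepMat n ^ m) z y ≤ ell n (rank y - m) / ell n (rank y) := by
  have hy := ell_rank_pos y
  have e : ∀ z, (stepMat n ^ m) z y
      = ell n (rank y - m) / ell n (rank y) * (stepMat n ^ m) (compl y) (compl z) := by
    intro z
    have h1 := stepMat_pow_compl m z y
    by_cases h0 : (stepMat n ^ m) z y = 0
    · rw [h0, zero_div, div_eq_zero_iff] at h1
      rw [h0, h1.resolve_right hy.ne', mul_zero]
    · have h2 := (rank_of_stepMat_pow_ne_zero h0).2
      have hz := ell_rank_pos z
      rw [show rank y - m = rank z by omega, div_mul_eq_mul_div, mul_div_assoc, h1]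
      field_simp
  rw [Finset.sum_congr rfl fun z _ => e z, ← Finset.mul_sum,
    sum_compl (fun z => (stepMat n ^ m) (compl y) z)]
  exact mul_le_of_le_one_right (by positivity) (stepMat_pow_sum_le m _)

lemma rank_zero {n : ℕ} : rank (0 : Vec n) = 0 := by simp [rank]

lemma eq_zero_of_rank {n : ℕ} {x : Vec n} (h : rank x = 0) : x = 0 := by
  funext a
  have := (Finset.sum_eq_zero_iff.1 h) a (mem_univ a)
  exact Fin.ext this

/-- The chain is uniform on each level: the reversed path from `compl x` reaches the top with
certainty. -/
lemma stepMat_pow_zero_left {n : ℕ} (x : Vec n) :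
    (stepMat n ^ rank x) 0 x = 1 / ell n (rank x) := by
  have h := stepMat_pow_compl (rank x) 0 x
  have hx := rank_add_rank_compl x
  have h0 := rank_add_rank_compl (0 : Vec n)
  rw [rank_zero] at h h0
  have e0 : (ell n 0 : ℝ) = 1 := by
    rw [ell, Nat.cast_eq_one, Finset.card_eq_one]
    refine ⟨0, ?_⟩
    ext y
    simp only [level, mem_filter, mem_univ, true_and, mem_singleton]
    exact ⟨eq_zero_of_rank, fun h => h ▸ rank_zero⟩
  have h1 : (stepMat n ^ rank x) (compl x) (compl 0) = 1 := by
    rw [← stepMat_pow_sum (rank x) (compl x) (by omega)]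
    refine (Finset.sum_eq_single_of_mem _ (mem_univ _) fun y _ hy => ?_).symm
    by_contra hne
    have h2 := (rank_of_stepMat_pow_ne_zero hne).2
    have h3 := rank_add_rank_compl y
    have h4 : compl y = 0 := eq_zero_of_rank (by omega)
    exact hy (by rw [← h4, compl_compl])
  rw [h1, e0, div_one] at h
  exact h.symm

/-! ### The random chain -/

open scoped ENNReal

lemma sum_map_mul {α β : Type*} [Fintype α] [Fintype β] (p : PMF α) (g : α → β) (f : β → ℝ≥0∞) :
    ∑ b, p.map g b * f b = ∑ a, p a * f (g a) := by
  classical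
  simp only [PMF.map_apply, tsum_fintype, Finset.sum_mul]
  rw [Finset.sum_comm]
  refine Finset.sum_congr rfl fun a _ => ?_
  rw [Finset.sum_eq_single (g a)]
  · simp
  · intro b _ hb; simp [hb]
  · simp

lemma sum_bind_mul {α β : Type*} [Fintype α] [Fintype β] (p : PMF α) (g : α → PMF β)
    (f : β → ℝ≥0∞) : ∑ b, p.bind g b * f b = ∑ a, p a * ∑ b, g a b * f b := by
  simp only [PMF.bind_apply, tsum_fintype, Finset.sum_mul, Finset.mul_sum]
  rw [Finset.sum_comm]
  exact Finset.sum_congr rfl fun a _ => Finset.sum_congr rfl fun b _ => by ring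

lemma sum_chainUpTo_succ (n m : ℕ) (f : (Fin (m + 2) → Vec n) → ℝ≥0∞) :
    ∑ c, chainUpTo n (m + 1) c * f c
      = ∑ c, chainUpTo n m c * ∑ y, step (c (Fin.last m)) y * f (Fin.snoc c y) := by
  rw [chainUpTo, sum_bind_mul]
  refine Finset.sum_congr rfl fun c _ => ?_
  rw [sum_map_mul]

lemma step_apply {n : ℕ} {x : Vec n} (hx : rank x < 2 * n) (y : Vec n) :
    step x y = ENNReal.ofReal (stepProb x y) := by
  rw [step, dif_pos hx]; rfl

lemma step_sum {n : ℕ} (x : Vec n) : ∑ y, step x y = 1 := by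
  rw [← tsum_fintype (L := .unconditional _)]; exact (step x).tsum_coe

open Classical in
/-- The joint distribution of two elements of the random chain. -/
lemma sum_chainUpTo_joint {n m : ℕ} (hm : m ≤ 2 * n) (l l' : Fin (m + 1)) (hl : l ≤ l')
    (x y : Vec n) :
    ∑ c, chainUpTo n m c * (if c l = x ∧ c l' = y then 1 else 0)
      = ENNReal.ofReal ((stepMat n ^ (l : ℕ)) 0 x * (stepMat n ^ (l' - l : ℕ)) x y) := by
  induction m generalizing x y with
  | zero =>
    obtain rfl : l = 0 := Fin.fin_one_eq_zero _
    obtain rfl : l' = 0 := Fin.fin_one_eq_zero _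
    rw [chainUpTo, Finset.sum_eq_single (fun _ => 0)]
    · by_cases h : (0 : Vec n) = x
      · subst h
        by_cases h' : (0 : Vec n) = y
        · simp [h']
        · simp [h']
      · simp [h, Matrix.one_apply]
    · intro c _ hc
      rw [PMF.pure_apply, if_neg hc, zero_mul]
    · simp
  | succ m ih =>
    rw [sum_chainUpTo_succ]
    induction l' using Fin.lastCases with
    | cast l' =>
      obtain ⟨l, rfl⟩ : ∃ k : Fin (m + 1), l = k.castSucc :=
        ⟨⟨l, lt_of_le_of_lt (Fin.le_def.1 hl) l'.isLt⟩, rfl⟩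
      have := ih (by omega) l l' (Fin.castSucc_le_castSucc_iff.1 hl) x y
      simp only [Fin.snoc_castSucc, Fin.val_castSucc, ← Finset.sum_mul, step_sum, one_mul]
      exact this
    | last =>
      -- The last step is separated by summing over the element `z` at level `m`, whose joint law
      -- with the earlier element is the induction hypothesis.
      have split : ∀ (i : Fin (m + 1)) (w v : Vec n),
          ∑ c, chainUpTo n m c * ((if c i = w then 1 else 0) * step (c (Fin.last m)) v)
            = ENNReal.ofReal ((stepMat n ^ (i : ℕ)) 0 w * (stepMat n ^ (m + 1 - i : ℕ)) w v) := by
        intro i w v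
        have h1 : ∀ c : Fin (m + 1) → Vec n,
            chainUpTo n m c * ((if c i = w then 1 else 0) * step (c (Fin.last m)) v)
            = ∑ z, (chainUpTo n m c * (if c i = w ∧ c (Fin.last m) = z then 1 else 0))
              * step z v := by
          intro c
          rw [Finset.sum_eq_single (c (Fin.last m))]
          · simp
          · intro z _ hz; simp [hz.symm]
          · simp
        rw [Finset.sum_congr rfl fun c _ => h1 c, Finset.sum_comm]
        simp only [← Finset.sum_mul]
        have h2 : ∀ z, (∑ c, chainUpTo n m c * (if c i = w ∧ c (Fin.last m) = z then 1 else 0))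
              * step z v
            = ENNReal.ofReal ((stepMat n ^ (i : ℕ)) 0 w * (stepMat n ^ (m - i : ℕ)) w z
              * stepProb z v) := by
          intro z
          rw [ih (by omega) i (Fin.last m) (Fin.le_last i) w z, Fin.val_last]
          -- `step` is given by `stepProb` only below the maximum; a non-zero product forces `rank z
          -- = m < 2n`.
          by_cases h0 : (stepMat n ^ (i : ℕ)) 0 w * (stepMat n ^ (m - i : ℕ)) w z = 0
          · rw [h0]; simp
          · have r1 := (rank_of_stepMat_pow_ne_zero (left_ne_zero_of_mul h0)).2
            have r2 := (rank_of_stepMat_pow_ne_zero (right_ne_zero_of_mul h0)).2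
            rw [rank_zero] at r1
            have := i.isLt
            rw [step_apply (by omega), ← ENNReal.ofReal_mul
              (mul_nonneg (stepMat_pow_nonneg _ _ _) (stepMat_pow_nonneg _ _ _))]
        rw [Finset.sum_congr rfl fun z _ => h2 z, ← ENNReal.ofReal_sum_of_nonneg fun z _ =>
          mul_nonneg (mul_nonneg (stepMat_pow_nonneg _ _ _) (stepMat_pow_nonneg _ _ _))
            (stepProb_nonneg _ _)]
        congr 1
        rw [show m + 1 - (i : ℕ) = (m - i) + 1 by have := i.isLt; omega, stepMat_pow_succ,
          Finset.mul_sum]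
        exact Finset.sum_congr rfl fun z _ => by ring
      induction l using Fin.lastCases with
      | cast l =>
        simp only [Fin.snoc_castSucc, Fin.snoc_last, Fin.val_castSucc, Fin.val_last]
        rw [← split]
        refine Finset.sum_congr rfl fun c _ => ?_
        rw [Finset.sum_eq_single y]
        · by_cases h : c l = x <;> simp [h]
        · intro z _ hz; simp [hz]
        · simp
      | last =>
        simp only [Fin.snoc_last, Fin.val_last, Nat.sub_self, pow_zero, Matrix.one_apply]
        by_cases hxy : x = y
        · subst hxy
          have h3 : ∀ c : Fin (m + 1) → Vec n,
              chainUpTo n m c * ∑ v, step (c (Fin.last m)) v * (if v = x ∧ v = x then 1 else 0)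
              = ∑ w, chainUpTo n m c
                * ((if c (Fin.last m) = w then 1 else 0) * step (c (Fin.last m)) x) := by
            intro c
            rw [← Finset.mul_sum, ← Finset.sum_mul]
            simp
          rw [Finset.sum_congr rfl fun c _ => h3 c, Finset.sum_comm,
            Finset.sum_congr rfl fun w _ => split (Fin.last m) w x,
            ← ENNReal.ofReal_sum_of_nonneg fun w _ =>
              mul_nonneg (stepMat_pow_nonneg _ _ _) (stepMat_pow_nonneg _ _ _),
            Fin.val_last, ← stepMat_pow_add, Nat.add_sub_cancel' (Nat.le_succ m)]
          simp
        · rw [if_neg hxy, mul_zero, ENNReal.ofReal_zero]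
          refine Finset.sum_eq_zero fun c _ => ?_
          rw [Finset.sum_eq_zero fun v _ => ?_, mul_zero]
          rw [if_neg (fun h => hxy (h.1.symm.trans h.2)), mul_zero]

/-- Lets the event that `x` lies in the chain be read off the single entry with index `rank x`. -/
lemma rank_of_mem_support {n m : ℕ} (hm : m ≤ 2 * n) {c : Fin (m + 1) → Vec n}
    (hc : chainUpTo n m c ≠ 0) (l : Fin (m + 1)) : rank (c l) = l := by
  classical
  have h := sum_chainUpTo_joint hm l l le_rfl (c l) (c l)
  have hpos : ∑ c', chainUpTo n m c' * (if c' l = c l ∧ c' l = c l then 1 else 0) ≠ 0 := by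
    intro h0
    have := (Finset.sum_eq_zero_iff.1 h0) c (mem_univ c)
    simp [hc] at this
  have h1 : (stepMat n ^ (l : ℕ)) 0 (c l) ≠ 0 := by
    intro h0
    rw [h0, zero_mul, ENNReal.ofReal_zero] at h
    exact hpos h
  have := (rank_of_stepMat_pow_ne_zero h1).2
  rw [rank_zero] at this
  omega

lemma chainMeasure_contains_inter {n : ℕ} {x y : Vec n} (hr : rank x ≤ rank y) :
    (chainMeasure n).real (contains x ∩ contains y)
      = 1 / ell n (rank x) * (stepMat n ^ (rank y - rank x)) x y := by
  classical
  have hx : rank x < 2 * n + 1 := by have := rank_le x; omega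
  have hy : rank y < 2 * n + 1 := by have := rank_le y; omega
  have hj := sum_chainUpTo_joint (le_refl (2 * n)) ⟨rank x, hx⟩ ⟨rank y, hy⟩ hr x y
  rw [MeasureTheory.Measure.real, chainMeasure, PMF.toMeasure_apply_fintype]
  have e : ∀ c, (contains x ∩ contains y).indicator (chainUpTo n (2 * n)) c
      = chainUpTo n (2 * n) c
        * (if c ⟨rank x, hx⟩ = x ∧ c ⟨rank y, hy⟩ = y then 1 else 0) := by
    intro c
    by_cases h0 : chainUpTo n (2 * n) c = 0
    · rw [h0, zero_mul, Set.indicator_apply, h0, ite_self]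
    · have hc := rank_of_mem_support le_rfl h0
      have hmem : ∀ (z : Vec n) (hz : rank z < 2 * n + 1),
          c ∈ contains z ↔ c ⟨rank z, hz⟩ = z := by
        refine fun z hz => ⟨?_, fun h => ⟨_, h⟩⟩
        rintro ⟨l, hl⟩
        have := hc l
        rw [hl] at this
        have hl' : (⟨rank z, hz⟩ : Fin (2 * n + 1)) = l := Fin.ext this
        rw [hl', hl]
      have hiff : c ∈ contains x ∩ contains y
          ↔ c ⟨rank x, hx⟩ = x ∧ c ⟨rank y, hy⟩ = y := by
        rw [Set.mem_inter_iff, hmem x hx, hmem y hy]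
      simp only [Set.indicator_apply, hiff, mul_ite, mul_one, mul_zero]
  rw [Finset.sum_congr rfl fun c _ => e c, hj, ENNReal.toReal_ofReal
    (mul_nonneg (stepMat_pow_nonneg _ _ _) (stepMat_pow_nonneg _ _ _)), stepMat_pow_zero_left]

lemma chainMeasure_contains {n : ℕ} (x : Vec n) :
    (chainMeasure n).real (contains x) = 1 / ell n (rank x) := by
  have := chainMeasure_contains_inter (le_refl (rank x))
  simpa using this

lemma cond_contains {n : ℕ} (x y : Vec n) :
    (ProbabilityTheory.cond (chainMeasure n) (contains x)).real (contains y)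
      = ell n (rank x) * (chainMeasure n).real (contains x ∩ contains y) := by
  rw [MeasureTheory.Measure.real, ProbabilityTheory.cond_apply (Set.toFinite _).measurableSet,
    ENNReal.toReal_mul, ENNReal.toReal_inv]
  change ((chainMeasure n).real (contains x))⁻¹ * _ = _
  rw [chainMeasure_contains, one_div, inv_inv]; rfl

lemma cond_contains_of_le {n : ℕ} {x y : Vec n} (hr : rank x ≤ rank y) :
    (ProbabilityTheory.cond (chainMeasure n) (contains x)).real (contains y)
      = (stepMat n ^ (rank y - rank x)) x y := by
  rw [cond_contains, chainMeasure_contains_inter hr]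
  have := (ell_rank_pos x).ne'
  field_simp

lemma cond_contains_of_ge {n : ℕ} {x y : Vec n} (hr : rank y ≤ rank x) :
    (ProbabilityTheory.cond (chainMeasure n) (contains x)).real (contains y)
      = (stepMat n ^ (rank x - rank y)) (compl x) (compl y) := by
  rw [cond_contains, Set.inter_comm, chainMeasure_contains_inter hr]
  have h := stepMat_pow_compl (rank x - rank y) y x
  have hx := (ell_rank_pos x).ne'
  have hy := (ell_rank_pos y).ne'
  rw [div_eq_div_iff hx hy] at h
  field_simp
  linarith

/-! ### Short pieces of the chain -/

lemma val_raise {n : ℕ} {x : Vec n} {a : Fin n} (ha : x a ≠ 2) :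
    ((raise x a a : Fin 3) : ℕ) = x a + 1 := by
  simp only [raise, Function.update_self]
  revert ha
  generalize x a = v
  revert v; decide

lemma card_ne_add_rank_le {n : ℕ} {x y : Vec n} (h : x ≤ y) :
    #{a | x a ≠ y a} + rank x ≤ rank y := by
  rw [rank, rank, Finset.card_filter, ← Finset.sum_add_distrib]
  refine Finset.sum_le_sum fun a _ => ?_
  have h1 : (x a : ℕ) ≤ y a := h a
  split_ifs with h2
  · have : (x a : ℕ) ≠ y a := fun hc => h2 (Fin.ext hc)
    omega
  · omega

/-- The first step must raise a coordinate in which `x` and `y` differ, and there are at most as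
many of these as steps remaining. -/
lemma stepMat_pow_le_factorial {n m : ℕ} {q : ℝ} (hq : 0 ≤ q) (x y : Vec n)
    (h : ∀ u v : Vec n, rank x ≤ rank u → rank u < rank x + m → stepProb u v ≤ q) :
    (stepMat n ^ m) x y ≤ m.factorial * q ^ m := by
  classical
  induction m generalizing x with
  | zero => rw [pow_zero, Matrix.one_apply]; split_ifs <;> simp
  | succ m ih =>
    by_cases h0 : (stepMat n ^ (m + 1)) x y = 0
    · rw [h0]; positivity
    obtain ⟨hxy, hr⟩ := rank_of_stepMat_pow_ne_zero h0
    have hcard := card_ne_add_rank_le hxy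
    rw [stepMat_pow_succ']
    calc ∑ z, stepProb x z * (stepMat n ^ m) z y
        = ∑ z ∈ (univ.filter fun a => x a ≠ y a).image (raise x),
            stepProb x z * (stepMat n ^ m) z y := by
          symm
          refine Finset.sum_subset (Finset.subset_univ _) fun z _ hz => ?_
          by_contra hne
          have h1 : x < z ∧ rank z = rank x + 1 := by
            by_contra hc
            exact hne (by rw [stepProb_eq_zero hc, zero_mul])
          have h2 := (rank_of_stepMat_pow_ne_zero (right_ne_zero_of_mul hne)).1
          obtain ⟨a, ha, rfl⟩ := exists_raise_of_cover h1.1 h1.2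
          refine hz (Finset.mem_image_of_mem _ (by
            simp only [mem_filter, mem_univ, true_and]
            intro hc
            have h3 : ((raise x a a : Fin 3) : ℕ) ≤ y a := h2 a
            rw [val_raise ha, ← hc] at h3
            omega))
      _ ≤ ∑ z ∈ (univ.filter fun a => x a ≠ y a).image (raise x),
            q * (m.factorial * q ^ m) := by
          refine Finset.sum_le_sum fun z _ => ?_
          by_cases h1 : x < z ∧ rank z = rank x + 1
          · refine mul_le_mul (h x z le_rfl (by omega)) (ih z fun u v hu hu' => ?_)
              (stepMat_pow_nonneg _ _ _) hq
            exact h u v (by omega) (by omega)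
          · rw [stepProb_eq_zero h1, zero_mul]; positivity
      _ ≤ (m + 1 : ℕ) * (q * (m.factorial * q ^ m)) := by
          rw [Finset.sum_const, nsmul_eq_mul]
          have : #((univ.filter fun a => x a ≠ y a).image (raise x)) ≤ m + 1 :=
            Finset.card_image_le.trans (by omega)
          gcongr
      _ = _ := by rw [Nat.factorial_succ, pow_succ]; push_cast; ring

/-- Averages the bound for the last `b` steps over the position after the first `m`. -/
lemma stepMat_pow_add_le_of_right {n m b : ℕ} {B : ℝ} (hB : 0 ≤ B) (x y : Vec n)
    (h : ∀ z : Vec n, rank z = rank x + m → (stepMat n ^ b) z y ≤ B) :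
    (stepMat n ^ (m + b)) x y ≤ B := by
  rw [stepMat_pow_add]
  calc _ ≤ ∑ z, (stepMat n ^ m) x z * B := by
        refine Finset.sum_le_sum fun z _ => ?_
        by_cases h0 : (stepMat n ^ m) x z = 0
        · rw [h0, zero_mul, zero_mul]
        · exact mul_le_mul_of_nonneg_left (h z (rank_of_stepMat_pow_ne_zero h0).2)
            (stepMat_pow_nonneg _ _ _)
    _ ≤ B := by
        rw [← Finset.sum_mul]
        exact mul_le_of_le_one_left hB (stepMat_pow_sum_le m x)

/-- Uses a bound for the first `m` steps instead; the price is a column sum, hence a ratio of level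
sizes. -/
lemma stepMat_pow_add_le_of_left {n m b : ℕ} {B : ℝ} (hB : 0 ≤ B) (x y : Vec n)
    (hb : b ≤ rank y) (h : ∀ z : Vec n, (stepMat n ^ m) x z ≤ B) :
    (stepMat n ^ (m + b)) x y ≤ B * (ell n (rank y - b) / ell n (rank y)) := by
  rw [stepMat_pow_add]
  calc _ ≤ ∑ z, B * (stepMat n ^ b) z y :=
        Finset.sum_le_sum fun z _ => mul_le_mul_of_nonneg_right (h z) (stepMat_pow_nonneg _ _ _)
    _ ≤ _ := by
        rw [← Finset.mul_sum]
        exact mul_le_mul_of_nonneg_left (sum_stepMat_pow_left_le y hb) hB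

/-! ### A supermartingale near the top level -/

/-- The number of ways to choose `d a` of the `2 - x a` missing units of every coordinate `a`. -/
noncomputable def deficitChoices {n : ℕ} (d : Fin n → ℕ) (x : Vec n) : ℝ :=
  ∏ a, ((2 - (x a : ℕ)).choose (d a) : ℝ)

lemma deficitChoices_nonneg {n : ℕ} (d : Fin n → ℕ) (x : Vec n) : 0 ≤ deficitChoices d x :=
  Finset.prod_nonneg fun _ _ => by positivity

lemma deficitChoices_le {n : ℕ} (d : Fin n → ℕ) (x : Vec n) :
    deficitChoices d x ≤ 2 ^ ∑ a, d a := by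
  rw [← Finset.prod_pow_eq_pow_sum]
  refine Finset.prod_le_prod (fun _ _ => by positivity) fun a _ => ?_
  have h1 : (2 - (x a : ℕ)).choose (d a) ≤ (2 - (x a : ℕ)) ^ d a := Nat.choose_le_pow _ _
  have h2 : (2 - (x a : ℕ)) ^ d a ≤ 2 ^ d a := Nat.pow_le_pow_left (by omega) _
  exact_mod_cast h1.trans h2

lemma one_le_deficitChoices {n : ℕ} {d : Fin n → ℕ} {x : Vec n}
    (h : ∀ a, d a + (x a : ℕ) ≤ 2) : 1 ≤ deficitChoices d x := by
  rw [deficitChoices, ← Finset.prod_const_one (ι := Fin n) (s := univ)]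
  refine Finset.prod_le_prod (fun _ _ => zero_le_one) fun a _ => ?_
  have : 0 < (2 - (x a : ℕ)).choose (d a) := Nat.choose_pos (by have := h a; omega)
  exact_mod_cast this

/-- Only the factor at `a` changes, by `C(D-1, d) D = C(D, d)(D - d)` with `D = 2 - x a`. -/
lemma deficitChoices_raise {n : ℕ} (d : Fin n → ℕ) {x : Vec n} {a : Fin n} (ha : x a ≠ 2) :
    deficitChoices d (raise x a) * (2 - (x a : ℕ)) = deficitChoices d x * (2 - (x a : ℕ) - d a) := by
  rw [deficitChoices, deficitChoices, ← Finset.mul_prod_erase _ _ (mem_univ a),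
    ← Finset.mul_prod_erase univ (fun b => ((2 - (x b : ℕ)).choose (d b) : ℝ)) (mem_univ a)]
  have h1 : ∏ b ∈ univ.erase a, ((2 - ((raise x a b : Fin 3) : ℕ)).choose (d b) : ℝ)
      = ∏ b ∈ univ.erase a, ((2 - (x b : ℕ)).choose (d b) : ℝ) := by
    refine Finset.prod_congr rfl fun b hb => ?_
    rw [raise, Function.update_of_ne (Finset.ne_of_mem_erase hb)]
  have hv : (x a : ℕ) ≤ 1 := by
    revert ha; generalize x a = v; revert v; decide
  rw [h1, val_raise ha]
  obtain ⟨D, hD⟩ : ∃ D, 2 - (x a : ℕ) = D + 1 := ⟨1 - x a, by omega⟩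
  have hD' : 2 - ((x a : ℕ) + 1) = D := by omega
  have hDr : (2 : ℝ) - (x a : ℕ) = D + 1 := by
    have : 2 = (x a : ℕ) + (D + 1) := by omega
    have : (2 : ℝ) = (x a : ℕ) + (D + 1) := by exact_mod_cast this
    linarith
  rw [hD, hD', hDr]
  have key : (D.choose (d a) : ℝ) * (D + 1) = (D + 1).choose (d a) * (D + 1 - d a) := by
    rcases le_or_gt (d a) (D + 1) with h | h
    · have := Nat.choose_mul_succ_eq D (d a)
      have h2 : ((D.choose (d a) * (D + 1) : ℕ) : ℝ)
          = (((D + 1).choose (d a) * (D + 1 - d a) : ℕ) : ℝ) := by rw [this]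
      push_cast [Nat.cast_sub h] at h2
      exact h2
    · rw [Nat.choose_eq_zero_of_lt h, Nat.choose_eq_zero_of_lt (by omega)]; simp
  linear_combination (∏ b ∈ univ.erase a, ((2 - (x b : ℕ)).choose (d b) : ℝ)) * key

lemma sum_stepProb_mul {n : ℕ} (x : Vec n) (f : Vec n → ℝ) :
    ∑ y, stepProb x y * f y
      = ∑ a ∈ univ.filter (fun a => x a ≠ 2), stepProb x (raise x a) * f (raise x a) := by
  classical
  rw [← Finset.sum_image (f := fun y => stepProb x y * f y) (g := raise x)
    (fun a ha b hb => raise_injOn x (by simpa using ha) (by simpa using hb)), ← covers_eq]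
  symm
  refine Finset.sum_subset (Finset.subset_univ _) fun y _ hy => ?_
  rw [stepProb_eq_zero (by simpa using hy), zero_mul]

/-- Raising `a` loses the fraction `d a / (2 - x a)` of the choices and has probability at least `(2
- x a) κ`, so the expected loss is at least the fraction `κ ∑ d a`. -/
lemma sum_stepProb_mul_deficitChoices_le {n : ℕ} (d : Fin n → ℕ) (x : Vec n) (hn : n ≤ rank x)
    (hx : rank x < 2 * n) : ∑ y, stepProb x y * deficitChoices d y
      ≤ deficitChoices d x * (1 - (∑ a, d a : ℕ) * (1 / (2 * n - rank x) - 3 / (2 * n))) := by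
  set κ : ℝ := 1 / (2 * n - rank x) - 3 / (2 * n) with hκ
  have h1 : ∑ a ∈ univ.filter (fun a => x a ≠ 2), stepProb x (raise x a) = 1 := by
    have := sum_stepProb_mul x (fun _ => 1)
    simp only [mul_one] at this
    rw [← this, stepProb_sum x hx]
  have h2 : ∀ a ∈ univ.filter (fun a => x a ≠ 2),
      stepProb x (raise x a) * deficitChoices d (raise x a)
        ≤ stepProb x (raise x a) * deficitChoices d x - deficitChoices d x * (d a * κ) := by
    intro a ha
    have ha : x a ≠ 2 := by simpa using ha
    have h3 := deficitChoices_raise d ha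
    have h4 := le_stepProb_raise ha hn
    rw [← hκ] at h4
    have hD : (0 : ℝ) < 2 - (x a : ℕ) := by
      have : (x a : ℕ) < 2 := by
        revert ha; generalize x a = v; revert v; decide
      have : ((x a : ℕ) : ℝ) < 2 := by exact_mod_cast this
      linarith
    have h5 := mul_le_mul_of_nonneg_left h4
      (mul_nonneg (deficitChoices_nonneg d x) (Nat.cast_nonneg (α := ℝ) (d a)))
    refine le_of_mul_le_mul_right ?_ hD
    calc _ = stepProb x (raise x a) * (deficitChoices d (raise x a) * (2 - (x a : ℕ))) := by ring
      _ = stepProb x (raise x a) * (deficitChoices d x * (2 - (x a : ℕ) - d a)) := by rw [h3]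
      _ ≤ _ := by linarith
  -- A coordinate already equal to `2` with `d a > 0` makes the product zero, so restricting the sum
  -- is harmless.
  have h6 : deficitChoices d x * ∑ a ∈ univ.filter (fun a => x a ≠ 2), (d a : ℝ)
      = deficitChoices d x * (∑ a, d a : ℕ) := by
    by_cases h0 : deficitChoices d x = 0
    · rw [h0, zero_mul, zero_mul]
    · congr 1
      push_cast
      refine Finset.sum_subset (Finset.subset_univ _) fun a _ ha => ?_
      have ha : x a = 2 := by simpa using ha
      have h7 := Finset.prod_ne_zero_iff.1 h0 a (mem_univ a)
      rw [ha] at h7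
      by_contra hda
      refine h7 ?_
      rw [Nat.choose_eq_zero_of_lt]
      · simp
      · have : d a ≠ 0 := fun h => hda (by rw [h]; simp)
        simpa using Nat.pos_of_ne_zero this
  rw [sum_stepProb_mul]
  refine (Finset.sum_le_sum h2).trans ?_
  rw [Finset.sum_sub_distrib, ← Finset.sum_mul, h1, ← Finset.mul_sum, ← Finset.sum_mul, ← mul_assoc,
    h6]
  linarith

/-- Bernoulli's inequality handles `1 - s/R`; the error `3s/(2n)` is absorbed because `((R-1)/R)^s ≥
2^{-s}` for `R ≥ 2`. The product form telescopes over `R`. -/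
lemma one_sub_mul_le_pow_mul {n R s : ℕ} (hR : 2 ≤ R) (hn : 0 < n) :
    1 - (s : ℝ) * (1 / R - 3 / (2 * n)) ≤ ((R - 1 : ℝ) / R) ^ s * (1 + 3 * s * 2 ^ s / 2 / n) := by
  have hR' : (2 : ℝ) ≤ R := by exact_mod_cast hR
  have hn' : (0 : ℝ) < n := by exact_mod_cast hn
  have e : ((R : ℝ) - 1) / R = 1 + -(1 / R) := by field_simp; ring
  have h1 : (1 : ℝ) / R ≤ 1 / 2 := by gcongr
  have hb := one_add_mul_le_pow (a := -(1 / (R : ℝ))) (by linarith) s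
  have hhalf : (1 / 2 : ℝ) ^ s ≤ (1 + -(1 / (R : ℝ))) ^ s := by gcongr; linarith
  rw [e]
  have h2 : 3 * (s : ℝ) / (2 * n) ≤ (1 + -(1 / (R : ℝ))) ^ s * (3 * s * 2 ^ s / 2 / n) := by
    calc 3 * (s : ℝ) / (2 * n) = (1 / 2 : ℝ) ^ s * (3 * s * 2 ^ s / 2 / n) := by
          rw [one_div, inv_pow]; field_simp
      _ ≤ _ := by gcongr
  have h3 : 1 - (s : ℝ) * (1 / R - 3 / (2 * n)) = 1 + s * -(1 / R) + 3 * s / (2 * n) := by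
    field_simp; ring
  rw [h3, mul_add, mul_one]
  linarith

lemma sum_stepMat_pow_mul_deficitChoices_le {n m s : ℕ} {d : Fin n → ℕ} (hd : ∑ a, d a = s)
    (hs : 1 ≤ s) (x : Vec n) (hn : n ≤ rank x) (hm : rank x + m + s ≤ 2 * n) :
    ∑ y, (stepMat n ^ m) x y * deficitChoices d y ≤ deficitChoices d x *
      (((2 * n - rank x - m : ℝ) / (2 * n - rank x)) ^ s * (1 + 3 * s * 2 ^ s / 2 / n) ^ m) := by
  have hn0 : 0 < n := by omega
  induction m generalizing x with
  | zero =>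
    have hr0 : (2 * n - rank x : ℝ) ≠ 0 := by
      have : rank x < 2 * n := by omega
      have : (rank x : ℝ) < 2 * n := by exact_mod_cast this
      linarith
    simp [Matrix.one_apply, div_self hr0]
  | succ m ih =>
    set C : ℝ := 1 + 3 * s * 2 ^ s / 2 / n with hC
    have hC0 : 0 ≤ C := by positivity
    obtain ⟨R, hR⟩ : ∃ R, rank x + R = 2 * n := ⟨2 * n - rank x, by omega⟩
    have hR2 : 2 ≤ R := by omega
    have hRr : (2 * n - rank x : ℝ) = R := by
      have : (rank x : ℝ) + R = 2 * n := by exact_mod_cast hR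
      linarith
    have hR2' : (2 : ℝ) ≤ R := by exact_mod_cast hR2
    have hRm : (0 : ℝ) ≤ R - m - 1 := by
      have : m + 1 ≤ R := by omega
      have : (m : ℝ) + 1 ≤ R := by exact_mod_cast this
      linarith
    set P : ℝ := ((R - m - 1 : ℝ) / (R - 1)) ^ s * C ^ m with hP
    have hP0 : 0 ≤ P := by
      have : (0 : ℝ) ≤ R - 1 := by linarith
      positivity
    have h1 : ∀ z, stepProb x z * ∑ y, (stepMat n ^ m) z y * deficitChoices d y
        ≤ stepProb x z * deficitChoices d z * P := by
      intro z
      by_cases hz : x < z ∧ rank z = rank x + 1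
      · have h2 := ih z (by omega) (by omega)
        have e : (2 * n - rank z : ℝ) = R - 1 := by rw [hz.2]; push_cast; linarith
        rw [e, show (R - 1 - m : ℝ) = R - m - 1 by ring, ← hP] at h2
        rw [mul_assoc]
        exact mul_le_mul_of_nonneg_left h2 (stepProb_nonneg x z)
      · rw [stepProb_eq_zero hz]; simp
    calc ∑ y, (stepMat n ^ (m + 1)) x y * deficitChoices d y
        = ∑ z, stepProb x z * ∑ y, (stepMat n ^ m) z y * deficitChoices d y := by
          simp only [stepMat_pow_succ', Finset.sum_mul, Finset.mul_sum]
          rw [Finset.sum_comm]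
          exact Finset.sum_congr rfl fun z _ => Finset.sum_congr rfl fun y _ => by ring
      _ ≤ ∑ z, stepProb x z * deficitChoices d z * P := Finset.sum_le_sum fun z _ => h1 z
      _ ≤ deficitChoices d x * (((R - 1 : ℝ) / R) ^ s * C) * P := by
          rw [← Finset.sum_mul]
          refine mul_le_mul_of_nonneg_right ?_ hP0
          refine (sum_stepProb_mul_deficitChoices_le d x hn (by omega)).trans ?_
          refine mul_le_mul_of_nonneg_left ?_ (deficitChoices_nonneg d x)
          rw [hRr, hd]
          exact one_sub_mul_le_pow_mul hR2 hn0
      _ = _ := by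
          rw [hRr, hP]
          have e1 : ((R : ℝ) - 1) / R * ((R - m - 1) / (R - 1)) = (R - m - 1) / R := by
            have : (R : ℝ) - 1 ≠ 0 := by linarith
            field_simp
          push_cast
          rw [show (R - (m + 1) : ℝ) = R - m - 1 by ring, ← e1, mul_pow, pow_succ]
          ring

lemma exists_deficit {n : ℕ} (y : Vec n) (s : ℕ) (h : rank y + s ≤ 2 * n) :
    ∃ d : Fin n → ℕ, ∑ a, d a = s ∧ ∀ a, d a + (y a : ℕ) ≤ 2 := by
  induction s with
  | zero => exact ⟨0, by simp, fun a => by have := (y a).isLt; simp; omega⟩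
  | succ s ih =>
    obtain ⟨d, hd, hle⟩ := ih (by omega)
    obtain ⟨a, ha⟩ : ∃ a, d a + (y a : ℕ) < 2 := by
      by_contra! hc
      have h1 : ∑ a : Fin n, 2 ≤ ∑ a, (d a + (y a : ℕ)) := Finset.sum_le_sum fun a _ => hc a
      rw [Finset.sum_add_distrib, hd] at h1
      simp only [sum_const, card_univ, Fintype.card_fin, smul_eq_mul] at h1
      change n * 2 ≤ s + rank y at h1
      omega
    refine ⟨fun b => d b + if b = a then 1 else 0, ?_, fun b => ?_⟩
    · rw [Finset.sum_add_distrib, hd]; simp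
    · have := hle b
      by_cases hb : b = a
      · subst hb; simp; omega
      · simp [hb]; omega

/-- The chain is unlikely to pass through a given element near the top. -/
lemma stepMat_pow_le_near_top {n s : ℕ} (hs : 1 ≤ s) (x y : Vec n) (hx : rank x = n)
    (hy : n ≤ rank y) (hys : rank y + s ≤ 2 * n) :
    (stepMat n ^ (rank y - n)) x y
      ≤ 2 ^ s * ((2 * n - rank y : ℝ) / n) ^ s * Real.exp (3 * s * 2 ^ s / 2) := by
  obtain ⟨d, hd, hle⟩ := exists_deficit y s hys
  have hn0 : (0 : ℝ) < n := by exact_mod_cast (by omega : 0 < n)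
  have h1 := sum_stepMat_pow_mul_deficitChoices_le (m := rank y - n) hd hs x hx.ge (by omega)
  -- Markov's inequality: `d` consists of units missing from `y`, so the functional is at least `1`
  -- at `y`.
  have h2 : (stepMat n ^ (rank y - n)) x y
      ≤ ∑ z, (stepMat n ^ (rank y - n)) x z * deficitChoices d z := by
    refine le_trans ?_ (Finset.single_le_sum (fun z _ => mul_nonneg (stepMat_pow_nonneg _ x z)
      (deficitChoices_nonneg d z)) (mem_univ y))
    exact le_mul_of_one_le_right (stepMat_pow_nonneg _ _ _) (one_le_deficitChoices hle)
  have h3 := deficitChoices_le d x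
  rw [hd] at h3
  have hyr : (rank y : ℝ) ≤ 2 * n := by exact_mod_cast rank_le y
  have e : (2 * n - rank x - (rank y - n : ℕ) : ℝ) / (2 * n - rank x) = (2 * n - rank y) / n := by
    rw [hx, Nat.cast_sub hy]; congr 1 <;> ring
  rw [e] at h1
  have hq : 0 ≤ (2 * n - rank y : ℝ) / n := div_nonneg (by linarith) hn0.le
  have h4 : (1 + 3 * s * 2 ^ s / 2 / n : ℝ) ^ (rank y - n) ≤ Real.exp (3 * s * 2 ^ s / 2) := by
    calc (1 + 3 * s * 2 ^ s / 2 / n : ℝ) ^ (rank y - n)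
        ≤ (1 + 3 * s * 2 ^ s / 2 / n : ℝ) ^ n := by
          refine pow_le_pow_right₀ ?_ (by have := rank_le y; omega)
          have : (0 : ℝ) ≤ 3 * s * 2 ^ s / 2 / n := by positivity
          linarith
      _ ≤ Real.exp (3 * s * 2 ^ s / 2 / n) ^ n := by
          gcongr
          linarith [Real.add_one_le_exp (3 * s * 2 ^ s / 2 / n : ℝ)]
      _ = _ := by
          rw [← Real.exp_nat_mul]; congr 1; field_simp
  refine (h2.trans h1).trans ?_
  rw [mul_assoc (2 ^ s)]
  gcongr

/-! ### Ratios of level sizes -/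

lemma ell_lt_ell_add {n a m : ℕ} (hm : 1 ≤ m) (h : a + m < n) :
    (ell n a : ℝ) < ell n (a + m) := by
  have step : ∀ t, t + 1 < n → (ell n t : ℝ) < ell n (t + 1) := by
    intro t ht
    have h1 := mul_ell_le_succ (n := n) (i := t) (by omega)
    have h2 : 0 < (ell n (t + 1) : ℝ) := ell_pos (by omega)
    have h3 : (t : ℝ) + 1 < n := by exact_mod_cast ht
    have h4 : (0 : ℝ) < n := by exact_mod_cast (by omega : 0 < n)
    nlinarith
  induction m, hm using Nat.le_induction with
  | base => exact step a h
  | succ m hm ih => exact (ih (by omega)).trans (step (a + m) (by omega))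

lemma ell_add_le_pow_mul {n a m : ℕ} {q : ℝ} (hq : 0 ≤ q)
    (h : ∀ t, a ≤ t → t < a + m → (n + t : ℝ) ≤ q * (t + 1)) :
    (ell n (a + m) : ℝ) ≤ q ^ m * ell n a := by
  induction m with
  | zero => simp
  | succ m ih =>
    have h1 := ih fun t ht ht' => h t ht (by omega)
    have h2 := h (a + m) (by omega) (by omega)
    have h3 := succ_mul_ell_succ_le n (a + m)
    have hpos : (0 : ℝ) < (a + m : ℕ) + 1 := by positivity
    have h4 : (ell n (a + m + 1) : ℝ) ≤ q * ell n (a + m) := by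
      refine le_of_mul_le_mul_left (h3.trans ?_) hpos
      have := mul_le_mul_of_nonneg_right h2 (Nat.cast_nonneg (α := ℝ) (ell n (a + m)))
      linarith
    calc (ell n (a + (m + 1)) : ℝ) ≤ q * ell n (a + m) := h4
      _ ≤ q * (q ^ m * ell n a) := by gcongr
      _ = _ := by ring

/-- The bound of the main theorem. -/
noncomputable def ratioBound (n k : ℕ) : ℝ :=
  ((ell n (3 * k - 1) : ℝ) / ell n (2 * k - 1) - 1)⁻¹

lemma le_ratioBound {n k : ℕ} {v : ℝ} (hk : 1 ≤ k) (hn : 3 * k < n)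
    (h : v * ((ell n (3 * k - 1) : ℝ) / ell n (2 * k - 1) - 1) ≤ 1) : v ≤ ratioBound n k := by
  have h1 : (ell n (2 * k - 1) : ℝ) < ell n (3 * k - 1) := by
    have := ell_lt_ell_add (n := n) (a := 2 * k - 1) (m := k) hk (by omega)
    rwa [show 2 * k - 1 + k = 3 * k - 1 by omega] at this
  have h2 : 0 < (ell n (2 * k - 1) : ℝ) := ell_pos (by omega)
  have h3 : 0 < (ell n (3 * k - 1) : ℝ) / ell n (2 * k - 1) - 1 := by
    rw [sub_pos, one_lt_div h2]; exact h1
  rw [ratioBound, ← one_div, le_div_iff₀ h3]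
  exact h

lemma le_ratioBound_of_mul_le {n k : ℕ} {v : ℝ} (hk : 1 ≤ k) (hn : 3 * k < n) (hv : 0 ≤ v)
    (h : v * ell n (3 * k - 1) ≤ ell n (2 * k - 1)) : v ≤ ratioBound n k := by
  have h2 : 0 < (ell n (2 * k - 1) : ℝ) := ell_pos (by omega)
  refine le_ratioBound hk hn ?_
  have : v * ((ell n (3 * k - 1) : ℝ) / ell n (2 * k - 1)) ≤ 1 := by
    rw [← mul_div_assoc, div_le_one h2]; exact h
  linarith

lemma one_div_pow_le_ratioBound {n k : ℕ} (hk : 1 ≤ k) (hn : 3 * k < n) :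
    1 / (n : ℝ) ^ k ≤ ratioBound n k := by
  have hn0 : (1 : ℝ) ≤ n := by exact_mod_cast (by omega : 1 ≤ n)
  have h := ell_add_le_pow_mul (n := n) (a := 2 * k - 1) (m := k) (q := n) (by linarith)
    fun t _ _ => by nlinarith [Nat.cast_nonneg (α := ℝ) t]
  rw [show 2 * k - 1 + k = 3 * k - 1 by omega] at h
  refine le_ratioBound_of_mul_le hk hn (by positivity) ?_
  rw [one_div, inv_mul_le_iff₀ (by positivity)]
  exact h

/-- Here the `-1` in the bound is needed: `ℓ_2/ℓ_1` is about `(n+1)/2`, and `2/n` exceeds `2/(n+1)`.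
-/
lemma two_div_le_ratioBound {n : ℕ} (hn : 3 < n) : 2 / (n : ℝ) ≤ ratioBound n 1 := by
  refine le_ratioBound le_rfl (by omega) ?_
  have h := succ_mul_ell_succ_le n 1
  have h2 : 0 < (ell n 1 : ℝ) := ell_pos (by omega)
  have hn0 : (0 : ℝ) < n := by exact_mod_cast (by omega : 0 < n)
  norm_num at h ⊢
  have h3 : (ell n 2 : ℝ) / ell n 1 ≤ (n + 1) / 2 := by
    rw [div_le_div_iff₀ h2 (by norm_num)]; linarith
  calc 2 / (n : ℝ) * (ell n 2 / ell n 1 - 1) ≤ 2 / n * ((n + 1) / 2 - 1) := by gcongr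
    _ = (n - 1) / n := by field_simp; ring
    _ ≤ 1 := by rw [div_le_one hn0]; linarith

/-- For `k ≥ 2` there is room to replace `2` by `9/4`: each ratio `ℓ_{t+1}/ℓ_t` is at most
`(n+t)/(t+1)`, and `(5/2)(m+1) ≤ 2k + m` for `m < k`. -/
lemma factorial_mul_le_ratioBound {n k : ℕ} (hk : 2 ≤ k) (hn : 27 * k ≤ n) :
    k.factorial * (9 / (4 * n) : ℝ) ^ k ≤ ratioBound n k := by
  have hn0 : (0 : ℝ) < n := by exact_mod_cast (by omega : 0 < n)
  have hn' : (27 : ℝ) * k ≤ n := by exact_mod_cast hn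
  have hk' : (2 : ℝ) ≤ k := by exact_mod_cast hk
  set q : ℝ := 9 / (4 * n) with hq
  -- The source of `27k ≤ n`: it gives `(9/4)(1 + 3k/n) ≤ (9/4)(10/9)`.
  have hqn : q * (n + 3 * k) ≤ 5 / 2 := by
    rw [hq, div_mul_eq_mul_div, div_le_div_iff₀ (by positivity) (by norm_num)]; linarith
  have hq0 : 0 < q := by positivity
  have key : ∀ m ≤ k, m.factorial * q ^ m * ell n (2 * k - 1 + m) ≤ ell n (2 * k - 1) := by
    intro m
    induction m with
    | zero => intro _; simp
    | succ m ih =>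
      intro hm
      refine le_trans ?_ (ih (by omega))
      have h1 := succ_mul_ell_succ_le n (2 * k - 1 + m)
      have hm' : (m : ℝ) + 1 ≤ k := by exact_mod_cast hm
      have hc : ((2 * k - 1 + m : ℕ) : ℝ) = 2 * k - 1 + m := by
        push_cast [Nat.cast_sub (show 1 ≤ 2 * k by omega)]; ring
      rw [hc] at h1
      have hl : (0 : ℝ) ≤ ell n (2 * k - 1 + m) := by positivity
      have h2 : ((m : ℝ) + 1) * q * (n + (2 * k - 1 + m)) ≤ 2 * k - 1 + m + 1 := by
        calc ((m : ℝ) + 1) * q * (n + (2 * k - 1 + m)) ≤ (m + 1) * q * (n + 3 * k) := by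
              gcongr; linarith
          _ = (m + 1) * (q * (n + 3 * k)) := by ring
          _ ≤ (m + 1) * (5 / 2) := by gcongr
          _ ≤ _ := by linarith
      have hp : (0 : ℝ) < 2 * k - 1 + m + 1 := by
        have := Nat.cast_nonneg (α := ℝ) m; linarith
      have h3 : ((m : ℝ) + 1) * q * ell n (2 * k - 1 + m + 1) ≤ ell n (2 * k - 1 + m) := by
        refine le_of_mul_le_mul_left ?_ hp
        calc _ = ((m : ℝ) + 1) * q * ((2 * k - 1 + m + 1) * ell n (2 * k - 1 + m + 1)) := by ring
          _ ≤ ((m : ℝ) + 1) * q * ((n + (2 * k - 1 + m)) * ell n (2 * k - 1 + m)) := by gcongr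
          _ = ((m : ℝ) + 1) * q * (n + (2 * k - 1 + m)) * ell n (2 * k - 1 + m) := by ring
          _ ≤ _ := by gcongr
      rw [Nat.factorial_succ, pow_succ]
      push_cast
      calc _ = m.factorial * q ^ m * (((m : ℝ) + 1) * q * ell n (2 * k - 1 + m + 1)) := by
            rw [← Nat.add_assoc]; ring
        _ ≤ _ := by gcongr
  have h := key k le_rfl
  rw [show 2 * k - 1 + k = 3 * k - 1 by omega] at h
  exact le_ratioBound_of_mul_le (by omega) (by omega) (by positivity) h

lemma factorial_mul_two_div_le_ratioBound {n k : ℕ} (hk : 1 ≤ k) (hn : 27 * k ≤ n) :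
    k.factorial * (2 / n : ℝ) ^ k ≤ ratioBound n k := by
  rcases hk.eq_or_lt with rfl | hk
  · simpa using two_div_le_ratioBound (n := n) (by omega)
  · refine le_trans ?_ (factorial_mul_le_ratioBound hk hn)
    have hn0 : (0 : ℝ) < n := by exact_mod_cast (by omega : 0 < n)
    have hq : (2 / n : ℝ) ≤ 9 / (4 * n) := by
      rw [div_le_div_iff₀ hn0 (by positivity)]; linarith
    gcongr

/-! ### The ranges of levels -/

lemma stepProb_le_near_middle {n K : ℕ} (hn : 9 * K + 8 ≤ n) (u v : Vec n)
    (hu : rank u < n + K) : stepProb u v ≤ 9 / (4 * n) := by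
  have hn0 : (0 : ℝ) < n := by exact_mod_cast (by omega : 0 < n)
  rcases lt_or_ge (rank u) n with h | h
  · refine (stepProb_le_of_lt u v h).trans ?_
    rw [div_le_div_iff₀ hn0 (by positivity)]; linarith
  · refine (stepProb_le_of_le u v (by omega) (by omega)).trans ?_
    have h1 : (n : ℝ) ≤ rank u := by exact_mod_cast h
    have h2 : (rank u : ℝ) ≤ n + K := by exact_mod_cast hu.le
    have h3 : 9 * (K : ℝ) + 8 ≤ n := by exact_mod_cast hn
    have hK : (0 : ℝ) ≤ K := by positivity
    have h4 : (rank u + 2 : ℝ) / (rank u + 1) ≤ (n + 2) / (n + 1) := by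
      rw [div_le_div_iff₀ (by positivity) (by positivity)]; linarith
    have h5 : (2 : ℝ) / (2 * n - rank u) ≤ 2 / (n - K) :=
      div_le_div_of_nonneg_left (by norm_num) (by linarith) (by linarith)
    calc (2 * (rank u + 2) / ((rank u + 1) * (2 * n - rank u)) : ℝ)
        = (rank u + 2) / (rank u + 1) * (2 / (2 * n - rank u)) := by
          rw [div_mul_div_comm]; ring
      _ ≤ (n + 2) / (n + 1) * (2 / (n - K)) := by
          refine mul_le_mul h4 h5 (div_nonneg (by norm_num) (by linarith)) (by positivity)
      _ ≤ 9 / (4 * n) := by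
          rw [div_mul_div_comm, div_le_div_iff₀ (by nlinarith) (by positivity)]
          nlinarith

lemma stepMat_pow_le_of_rank_le {n k : ℕ} {q : ℝ} (hq : 0 ≤ q) (x y : Vec n)
    (h : ∀ u v : Vec n, rank u < rank y → stepProb u v ≤ q) {b : ℕ} (hkb : k ≤ b)
    (hb : rank x + b = rank y) : (stepMat n ^ b) x y ≤ k.factorial * q ^ k := by
  obtain ⟨m, rfl⟩ : ∃ m, b = m + k := ⟨b - k, by omega⟩
  refine stepMat_pow_add_le_of_right (by positivity) x y fun z hz => ?_
  exact stepMat_pow_le_factorial hq z y fun u v _ hu => h u v (by omega)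

/-- The path is cut at level `c`, which has the size of the level of `y`, so the ratio paid for the
remaining steps is `1`. -/
lemma stepMat_pow_le_of_rank_compl {n k c : ℕ} (x y : Vec n) (hc : rank y + c = 2 * n)
    (hcn : c ≤ n) (hx : rank x + k ≤ c) :
    (stepMat n ^ (rank y - rank x)) x y ≤ k.factorial * (2 / n : ℝ) ^ k := by
  have hB : (0 : ℝ) ≤ k.factorial * (2 / n : ℝ) ^ k := by positivity
  have h := stepMat_pow_add_le_of_left (m := c - rank x) (b := rank y - c) hB x y (by omega)
    fun z => by
      by_cases h0 : (stepMat n ^ (c - rank x)) x z = 0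
      · rw [h0]; exact hB
      have hz := (rank_of_stepMat_pow_ne_zero h0).2
      exact stepMat_pow_le_of_rank_le (by positivity) x z
        (fun u v hu => stepProb_le_of_lt u v (by omega)) (by omega) (by omega)
  rw [show c - rank x + (rank y - c) = rank y - rank x by omega,
    show rank y - (rank y - c) = c by omega, ell_compl hc, div_self (ell_rank_pos y).ne',
    mul_one] at h
  exact h

/-- With `K = 2k + 2`, the first `K` steps give `K! (2/n)^K` and the remaining ones cost a ratio at
most `(2n/c)^K`. The product `K! 4^K / c^K` is at most a constant times `n^{-(k+1)}`, and the spare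
factor `1/n` absorbs the constant. -/
lemma stepMat_pow_le_of_sq {n k c N : ℕ} (x y : Vec n) (hc : rank y + c = 2 * n)
    (hxc : rank x ≤ c) (hcx : c ≤ rank x + k) (hcn : c + (2 * k + 2) ≤ n) (hcN : n ≤ N * c ^ 2)
    (hc0 : 0 < c)
    (hn : (2 * k + 2).factorial * 4 ^ (2 * k + 2) * N ^ (k + 1) ≤ n) :
    (stepMat n ^ (rank y - rank x)) x y ≤ 1 / (n : ℝ) ^ k := by
  set K := 2 * k + 2 with hK
  have hn0 : (0 : ℝ) < n := by exact_mod_cast (by omega : 0 < n)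
  have hc0' : (0 : ℝ) < c := by exact_mod_cast hc0
  have hB : (0 : ℝ) ≤ K.factorial * (2 / n : ℝ) ^ K := by positivity
  have h := stepMat_pow_add_le_of_left (m := K) (b := rank y - rank x - K) hB x y (by omega)
    fun z => stepMat_pow_le_factorial (by positivity) x z
      fun u v _ hu => stepProb_le_of_lt u v (by omega)
  rw [show K + (rank y - rank x - K) = rank y - rank x by omega,
    show rank y - (rank y - rank x - K) = rank x + K by omega] at h
  refine h.trans ?_
  have hq1 : 1 ≤ 2 * (n : ℝ) / c := by
    rw [one_le_div hc0']
    have : (c : ℝ) ≤ n := by exact_mod_cast (by omega : c ≤ n)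
    linarith
  have hratio : (ell n (rank x + K) : ℝ) / ell n (rank y) ≤ (2 * n / c) ^ K := by
    rw [← ell_compl hc, div_le_iff₀ (ell_pos (by omega))]
    obtain ⟨m, hm⟩ : ∃ m, rank x + K = c + m := ⟨rank x + K - c, by omega⟩
    rw [hm]
    refine (ell_add_le_pow_mul (q := 2 * n / c) (by positivity) fun t ht ht' => ?_).trans ?_
    · have h1 : (c : ℝ) ≤ t := by exact_mod_cast ht
      have h2 : (t : ℝ) ≤ n := by exact_mod_cast (by omega : t ≤ n)
      rw [div_mul_eq_mul_div, le_div_iff₀ hc0']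
      nlinarith
    · exact mul_le_mul_of_nonneg_right (pow_le_pow_right₀ hq1 (by omega)) (Nat.cast_nonneg _)
  have hNr : (n : ℝ) ≤ N * c ^ 2 := by exact_mod_cast hcN
  have hcN' : 1 / (c : ℝ) ^ 2 ≤ N / n := by
    rw [div_le_div_iff₀ (by positivity) hn0]; linarith
  have hn' : ((K.factorial : ℝ) * 4 ^ K * N ^ (k + 1)) ≤ n := by exact_mod_cast hn
  calc _ ≤ K.factorial * (2 / n : ℝ) ^ K * (2 * n / c) ^ K := by gcongr
    _ = K.factorial * 4 ^ K * (1 / (c : ℝ) ^ 2) ^ (k + 1) := by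
        rw [mul_assoc, ← mul_pow, mul_assoc,
          show (2 / n : ℝ) * (2 * n / c) = 4 * (1 / c) by field_simp; norm_num, mul_pow,
          one_div, one_div, inv_pow, inv_pow, ← pow_mul, show 2 * (k + 1) = K by omega]
    _ ≤ K.factorial * 4 ^ K * (N / n : ℝ) ^ (k + 1) := by gcongr
    _ = K.factorial * 4 ^ K * N ^ (k + 1) / n ^ (k + 1) := by rw [div_pow]; ring
    _ ≤ n / n ^ (k + 1) := by gcongr
    _ = 1 / (n : ℝ) ^ k := by rw [pow_succ]; field_simp

/-- With `s = 2k` tracked units the bound from level `n` onwards is `(4c²/n²)^k E ≤ (4/(Nn))^k E`,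
and `N ≥ 4E` brings it down to `n^{-k}`. -/
lemma stepMat_pow_le_of_small_corank {n k c N : ℕ} (hk : 1 ≤ k) (x y : Vec n)
    (hc : rank y + c = 2 * n) (hx : rank x ≤ n) (hcn : c ≤ n) (hck : 2 * k ≤ c)
    (hcN : N * c ^ 2 ≤ n)
    (hN : 4 * Real.exp (3 * (2 * k : ℕ) * 2 ^ (2 * k) / 2) ≤ N) :
    (stepMat n ^ (rank y - rank x)) x y ≤ 1 / (n : ℝ) ^ k := by
  have hn0 : (0 : ℝ) < n := by exact_mod_cast (by omega : 0 < n)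
  set E := Real.exp (3 * (2 * k : ℕ) * 2 ^ (2 * k) / 2) with hE
  have hE1 : 1 ≤ E := Real.one_le_exp (by positivity)
  have hN0 : (0 : ℝ) < N := by linarith
  have hNr : (N : ℝ) * c ^ 2 ≤ n := by exact_mod_cast hcN
  rw [show rank y - rank x = (n - rank x) + (rank y - n) by omega]
  refine stepMat_pow_add_le_of_right (by positivity) x y fun z hz => ?_
  have h := stepMat_pow_le_near_top (s := 2 * k) (by omega) z y (by omega) (by omega) (by omega)
  have hcr : (2 * n - rank y : ℝ) = c := by
    have : (rank y : ℝ) + c = 2 * n := by exact_mod_cast hc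
    linarith
  rw [hcr, ← hE] at h
  refine h.trans ?_
  have h1 : 4 / (N : ℝ) ≤ 1 := by rw [div_le_one hN0]; linarith
  calc (2 : ℝ) ^ (2 * k) * (c / n) ^ (2 * k) * E = (4 * c ^ 2 / n ^ 2) ^ k * E := by
        rw [pow_mul, pow_mul, ← mul_pow]; congr 2; rw [div_pow]; ring
    _ ≤ (4 / N * (1 / n)) ^ k * E := by
        gcongr
        rw [div_mul_div_comm, div_le_div_iff₀ (by positivity) (by positivity)]
        nlinarith
    _ = (4 / N : ℝ) ^ k * E * (1 / n ^ k) := by rw [mul_pow, div_pow 1, one_pow]; ring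
    _ ≤ (4 / N : ℝ) * E * (1 / n ^ k) := by
        gcongr
        exact pow_le_of_le_one (by positivity) h1 (by omega)
    _ ≤ 1 * (1 / n ^ k) := by
        gcongr
        rw [div_mul_eq_mul_div, div_le_one hN0]; exact hN
    _ = _ := one_mul _

/-- The upward version of the main theorem. -/
lemma exists_forall_stepMat_pow_le (k : ℕ) (hk : 1 ≤ k) : ∃ n₀ : ℕ, ∀ n, n₀ ≤ n →
    ∀ x y : Vec n, rank x + k ≤ rank y → rank x + rank y ≤ 2 * n → rank y + 2 * k ≤ 2 * n →
      (stepMat n ^ (rank y - rank x)) x y ≤ ratioBound n k := by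
  obtain ⟨N, hN⟩ := exists_nat_ge (4 * Real.exp (3 * (2 * k : ℕ) * 2 ^ (2 * k) / 2))
  refine ⟨(2 * k + 2).factorial * 4 ^ (2 * k + 2) * N ^ (k + 1) + (27 * k + (9 * (2 * k + 2) + 8)),
    fun n hn x y hxy hsum hy => ?_⟩
  have hn0 : (0 : ℝ) < n := by exact_mod_cast (by omega : 0 < n)
  have hlast : ∀ b, rank x + b = rank y → rank y < n + (2 * k + 2) →
      ∀ s ≤ b, (stepMat n ^ b) x y ≤ s.factorial * (9 / (4 * n) : ℝ) ^ s := fun b hb hy' s hs =>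
    stepMat_pow_le_of_rank_le (by positivity) x y
      (fun u v hu => stepProb_le_near_middle (K := 2 * k + 2) (by omega) u v (by omega)) hs hb
  rcases le_or_gt (rank y) n with h1 | h1
  · exact (stepMat_pow_le_of_rank_le (by positivity) x y
      (fun u v hu => stepProb_le_of_lt u v (by omega)) (b := rank y - rank x) (k := k) (by omega)
      (by omega)).trans (factorial_mul_two_div_le_ratioBound hk (by omega))
  obtain ⟨c, hc⟩ : ∃ c, rank y + c = 2 * n := ⟨2 * n - rank y, by omega⟩
  rcases le_or_gt (rank x + k) c with h2 | h2
  · exact (stepMat_pow_le_of_rank_compl x y hc (by omega) h2).trans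
      (factorial_mul_two_div_le_ratioBound hk (by omega))
  rcases lt_or_ge n (c + (2 * k + 2)) with h3 | h3
  -- For `k = 1` one step of probability `9/(4n)` is too weak against `2/n`; but `rank x < n < rank
  -- y` provides two steps.
  · rcases hk.eq_or_lt with rfl | hk2
    · refine (hlast (rank y - rank x) (by omega) (by omega) 2 (by omega)).trans
        (le_trans ?_ (two_div_le_ratioBound (by omega)))
      have : (27 : ℝ) ≤ n := by exact_mod_cast (by omega : 27 ≤ n)
      rw [div_pow, Nat.factorial_two, ← mul_div_assoc, div_le_div_iff₀ (by positivity) hn0]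
      push_cast
      nlinarith
    · exact (hlast (rank y - rank x) (by omega) (by omega) k (by omega)).trans
        (factorial_mul_le_ratioBound hk2 (by omega))
  refine le_trans ?_ (one_div_pow_le_ratioBound hk (by omega))
  rcases le_total n (N * c ^ 2) with h4 | h4
  · exact stepMat_pow_le_of_sq x y hc (by omega) (by omega) h3 h4 (by omega) (by omega)
  · exact stepMat_pow_le_of_small_corank hk x y hc (by omega) (by omega) (by omega) h4 hN

end Vec

theorem mainTheorem11 (k : ℕ) (hk : 1 ≤ k) :
    ∃ n₀ : ℕ, ∀ n : ℕ, n₀ ≤ n → ∀ i j : ℕ, i ≤ 2 * n → j ≤ 2 * n →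
      (k : ℤ) ≤ |(i : ℤ) - j| →
      (2 * k ≤ min i j ∨ (max i j : ℤ) ≤ 2 * n - 2 * k) →
      |(j : ℤ) - n| ≤ |(i : ℤ) - n| →
      ∀ x ∈ Vec.level n i, ∀ y ∈ Vec.level n j, (x ≤ y ∨ y ≤ x) →
        (ProbabilityTheory.cond (Vec.chainMeasure n) (Vec.contains x)).real (Vec.contains y) ≤
          ((Vec.ell n (3 * k - 1) : ℝ) / Vec.ell n (2 * k - 1) - 1)⁻¹ := by
  obtain ⟨n₀, h⟩ := Vec.exists_forall_stepMat_pow_le k hk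
  refine ⟨n₀, fun n hn i j hi hj hij hk2 hmid x hx y hy _ => ?_⟩
  obtain rfl : Vec.rank x = i := by simpa [Vec.level] using hx
  obtain rfl : Vec.rank y = j := by simpa [Vec.level] using hy
  change _ ≤ Vec.ratioBound n k
  -- Squaring turns the distance condition into `(j - i)(i + j - 2n) ≤ 0`, so `i + j - 2n` has the
  -- sign that reduces each direction, after complementation when `y` is below `x`, to the upward
  -- statement.
  have hmid' := sq_le_sq.2 hmid
  have hprod : ((Vec.rank y : ℤ) - Vec.rank x) * (Vec.rank y + Vec.rank x - 2 * n) ≤ 0 := by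
    linarith
  rcases le_total (Vec.rank x) (Vec.rank y) with hle | hle
  · rw [abs_of_nonpos (by omega)] at hij
    have hsum : (Vec.rank y : ℤ) + Vec.rank x - 2 * n ≤ 0 := by
      by_contra! hc
      have : (0 : ℤ) < (Vec.rank y : ℤ) - Vec.rank x := by omega
      exact absurd hprod (not_le.2 (mul_pos this hc))
    rw [Vec.cond_contains_of_le hle]
    exact h n hn x y (by omega) (by omega) (by omega)
  · rw [abs_of_nonneg (by omega)] at hij
    have hsum : 0 ≤ (Vec.rank y : ℤ) + Vec.rank x - 2 * n := by
      by_contra! hc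
      have : (Vec.rank y : ℤ) - Vec.rank x < 0 := by omega
      exact absurd hprod (not_le.2 (mul_pos_of_neg_of_neg this hc))
    have rx := Vec.rank_add_rank_compl x
    have ry := Vec.rank_add_rank_compl y
    rw [Vec.cond_contains_of_ge hle, show Vec.rank x - Vec.rank y
      = Vec.rank (Vec.compl y) - Vec.rank (Vec.compl x) by omega]
    exact h n hn _ _ (by omega) (by omega) (by omega)
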